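/- Consider $K \ge 1$ arms and a horizon $T$. An environment consists of reward distributions $f_t^k$ on $\mathbb R$ $(1\le t\le T,\ 1\le k\le K)$ with means $\mu_t^k$. In time slot $t$ a policy selects an arm $\varphi_t$ on the basis of the past observations $(\varphi_s,X_s)_{s<t}$ and receives a reward $X_t$ which, given the past and $\varphi_t=k$, has distribution $f_t^k$. With $\mu_t^*=\max_k\mu_t^k$, the regret of a policy is $$R_T=\mathbb E\Big[\sum_{t=1}^T(\mu_t^*-\mu_t^{\varphi_t})\Big].$$ For $V>0$, $a\in\mathbb R$ and $b>0$ let $\mathcal E_{a,b}(V,T,K)$ be the set of environments such that, for all $t\le T$ and all $k$, $\int e^{\lambda(x-\mu_t^k)}\,df_t^k(x)\le e^{\lambda^2/8}$ for every $\lambda\in\mathbb R$ and $\mu_t^k\in[a,a+b]$, and such that $$\sum_{t=1}^{T-1}\max_{k}|\mu_{t+1}^k-\mu_t^k|\le V .$$ Sliding-Window MOSS (SW-MOSS) with parameter $\eta>1/2$ and window length $\tau\in\mathbb N$ picks each arm once in the first $K$ time slots. In every later slot $t$ it picks an arm $k$ that maximizes the index $$g_t^k=\frac1{n_k(t)}\sum_{s\in\mathcal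 W_t,\ \varphi_s=k}X_s+\sqrt{\frac{\eta\,\max\big(\ln\frac{\tau}{K\,n_k(t)},\,0\big)}{n_k(t)}},\qquad n_k(t)=\big|\{s\in\mathcal W_t:\varphi_s=k\}\big|,$$ where $\mathcal W_t=\{\max(1,t-\tau),\dots,t-1\}$ and $g_t^k=+\infty$ if $n_k(t)=0$. The order of the first $K$ picks is arbitrary, and ties are broken arbitrarily. **Theorem.** For all $\eta>1/2$ and $b>0$ there is a constant $C$, depending only on $\eta$ and $b$, such that for all $a\in\mathbb R$, all $K\ge1$, all $T$ and all $V>0$ for which $\tau=\lceil K^{1/3}(T/V)^{2/3}\rceil$ satisfies $\tau\le T$, SW-MOSS with parameter $\eta$ and window length $\tau$ has worst-case regret $$\sup_{\mathcal E_{a,b}(V,T,K)}R_T\;\le\; C\,(KV)^{1/3}\,T^{2/3}.$$ -/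

import Mathlib

open MeasureTheory ProbabilityTheory

noncomputable section

namespace Bandit

/-- Observations of the first `t` rounds: the selected arm and the received reward of each.
Rounds are numbered from `0`, so that round `t` here is time slot `t + 1`. -/
abbrev Hist (K t : ℕ) : Type := Fin t → Fin K × ℝ

/-- A (possibly randomized) policy: the conditional distribution of the arm selected in round `t`,
given the observations of the rounds before. -/
structure Policy (K : ℕ) where
  act : (t : ℕ) → Kernel (Hist K t) (Fin K)
  markov : ∀ t, IsMarkovKernel (act t)

/-- Reward distributions `f_t^k`; for a horizon `T` only the rounds `t < T` matter. -/
abbrev Env (K : ℕ) : Type := ℕ → Fin K → ProbabilityMeasure ℝ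

/-- The mean reward `μ_t^k`. -/
def Env.mean {K : ℕ} (F : Env K) (t : ℕ) (k : Fin K) : ℝ :=
  ∫ x, x ∂(F t k : Measure ℝ)

/-- The mean reward `μ_t^*` of the best arm. -/
def Env.bestMean {K : ℕ} (F : Env K) (t : ℕ) : ℝ := ⨆ k, F.mean t k

/-- The total variation of the mean rewards over the horizon `T`. -/
def Env.variation {K : ℕ} (F : Env K) (T : ℕ) : ℝ :=
  ∑ t ∈ Finset.range (T - 1), ⨆ k, |F.mean (t + 1) k - F.mean t k|

/-- The environments over the horizon `T` with total variation at most `V`, whose rewards satisfy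
`E exp (l (X - μ)) ≤ exp (l ^ 2 / 8)` for all real `l` and have means in `[a, a + b]`. -/
def envClass (K T : ℕ) (V a b : ℝ) : Set (Env K) :=
  {F | (∀ t < T, ∀ k,
          HasSubgaussianMGF (fun x : ℝ => x - F.mean t k) (1 / 4) (F t k : Measure ℝ) ∧
          F.mean t k ∈ Set.Icc a (a + b)) ∧
       F.variation T ≤ V}

/-- The reward distribution in round `t` as a function of the selected arm. -/
def Env.rewardKernel {K : ℕ} (F : Env K) (t : ℕ) : Kernel (Fin K) ℝ :=
  Kernel.ofFunOfCountable fun k => (F t k : Measure ℝ)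

/-- The law of the observations of the first `t` rounds: in each round an arm is drawn by the
policy from the past observations, and then its reward is drawn independently of the past. -/
def Policy.law {K : ℕ} (π : Policy K) (F : Env K) : (t : ℕ) → Measure (Hist K t)
  | 0 => Measure.dirac Fin.elim0
  | t + 1 =>
      (π.law F t ⊗ₘ (π.act t ⊗ₖ Kernel.prodMkLeft (Hist K t) (F.rewardKernel t))).map
        fun p => (Fin.snoc p.1 p.2 : Hist K (t + 1))

/-- The regret `E [∑ t, (μ_t^* - μ_t^{φ_t})]` over the horizon `T`. -/
def Policy.regret {K : ℕ} (π : Policy K) (F : Env K) (T : ℕ) : ℝ :=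
  ∫ h, ∑ t : Fin T, (F.bestMean t - F.mean t (h t).1) ∂(π.law F T)

/-- The supremum of the regret over the environments in `envClass K T V a b`. -/
def Policy.worstCaseRegret {K : ℕ} (π : Policy K) (T : ℕ) (V a b : ℝ) : EReal :=
  ⨆ F ∈ envClass K T V a b, (π.regret F T : EReal)

/-- The rounds among the last `τ` ones before round `t` in which arm `k` was selected. -/
def windowPicks {K t : ℕ} (τ : ℕ) (h : Hist K t) (k : Fin K) : Finset (Fin t) :=
  {s : Fin t | t ≤ (s : ℕ) + τ ∧ (h s).1 = k}

/-- The index of arm `k` in round `t`, computed within the sliding window. It is infinite for an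
arm without a sample in the window. -/
def swIndex {K t : ℕ} (η : ℝ) (τ : ℕ) (h : Hist K t) (k : Fin K) : EReal :=
  let n : ℕ := (windowPicks τ h k).card
  if n = 0 then ⊤
  else (((∑ s ∈ windowPicks τ h k, (h s).2) / n
    + √(η * (max (Real.log (τ / (K * n))) 0 / n)) : ℝ) : EReal)

/-- `π` is Sliding-Window MOSS with window length `τ` up to the horizon `T`: in the first `K` rounds
it picks each arm once, in any order; from then on it picks an arm of maximal index, where ties may
be broken in any way. -/
structure Policy.IsSWMOSS {K : ℕ} (π : Policy K) (η : ℝ) (τ T : ℕ) : Prop where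
  init : ∀ t < T, t < K → ∀ (h : Hist K t) (k : Fin K),
    π.act t h {k} ≠ 0 → ∀ s, (h s).1 ≠ k
  argmax : ∀ t < T, K ≤ t → ∀ (h : Hist K t) (k : Fin K),
    π.act t h {k} ≠ 0 → ∀ j, swIndex η τ h j ≤ swIndex η τ h k

/-- The window length `⌈K ^ (1/3) (T / V) ^ (2/3)⌉`. -/
def swWindow (K T : ℕ) (V : ℝ) : ℕ :=
  ⌈(K : ℝ) ^ (1 / 3 : ℝ) * ((T : ℝ) / V) ^ (2 / 3 : ℝ)⌉₊

end Bandit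

end

/-!
In every round the regret of SW-MOSS is at most twice the drift of the means within the window, plus
the *shortfall* (how far the index of the best arm falls below its mean), plus the *excess* (how far
the index of the selected arm exceeds its mean); rounds in which the selected arm has no sample in
the window cost `b` each, and occur at most `K` times in an epoch of `τ` rounds.

Write `H = τ / K`. The exponential supermartingale of the centred rewards, peeled dyadically over
the number of samples, bounds the expected shortfall of a round by a multiple of `1 / √H`; the
peeling converges because `η` is larger than twice the variance proxy. Arms are not analysed
separately for the excess. Within an epoch, a window sum of an arm's noise is a difference of sums
over initial segments of its selections, and dyadic chaining over blocks of selections controls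
all of them at once by eighth moments. The expected excess summed over an epoch is then a multiple
of `K √H = √(K τ)`.

In total the regret is at most a multiple of `T √(K / τ)` plus `2 τ V`, and the window length
balances the two terms.
-/

noncomputable section

namespace Bandit

/-! ### Dyadic scales and power sums -/

theorem min_inv_le_telescope {ρ x : ℝ} (hρ : 1 < ρ) (hx : 0 < x) :
    min x x⁻¹ ≤ 4 * (ρ / (ρ - 1)) * (ρ * x / (1 + ρ * x) - x / (1 + x)) := by
  have hρ1 : 0 < ρ - 1 := sub_pos.2 hρ
  have hmin : min x x⁻¹ ≤ 4 * x / (1 + x) ^ 2 := by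
    rcases le_total x 1 with h | h
    · refine (min_le_left _ _).trans ?_
      rw [le_div_iff₀ (by positivity)]
      nlinarith [mul_nonneg hx.le (mul_nonneg (sub_nonneg.2 h) (by linarith : 0 ≤ 3 + x))]
    · refine (min_le_right _ _).trans ?_
      rw [inv_eq_one_div, div_le_div_iff₀ hx (by positivity)]
      nlinarith
  calc min x x⁻¹ ≤ 4 * x / (1 + x) ^ 2 := hmin
    _ ≤ 4 * ρ * x / ((1 + ρ * x) * (1 + x)) := by
        rw [div_le_div_iff₀ (by positivity) (by positivity)]
        nlinarith [mul_nonneg (mul_nonneg hx.le (by linarith : 0 ≤ 1 + x)) hρ1.le]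
    _ = 4 * (ρ / (ρ - 1)) * (ρ * x / (1 + ρ * x) - x / (1 + x)) := by
        field_simp
        ring

theorem sum_min_inv_geom_le {ρ y : ℝ} (hρ : 1 < ρ) (hy : 0 < y) (n : ℕ) :
    ∑ i ∈ Finset.range n, min (y * ρ ^ i) (y * ρ ^ i)⁻¹ ≤ 4 * (ρ / (ρ - 1)) := by
  have hρ0 : 0 < ρ := one_pos.trans hρ
  have hρ1 : 0 < ρ - 1 := sub_pos.2 hρ
  set g : ℕ → ℝ := fun i => y * ρ ^ i / (1 + y * ρ ^ i)
  have hterm : ∀ i, min (y * ρ ^ i) (y * ρ ^ i)⁻¹ ≤ 4 * (ρ / (ρ - 1)) * (g (i + 1) - g i) := by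
    intro i
    have h := min_inv_le_telescope hρ (by positivity : 0 < y * ρ ^ i)
    rwa [show ρ * (y * ρ ^ i) = y * ρ ^ (i + 1) by ring] at h
  have hg0 : 0 ≤ g 0 := by positivity
  have hg1 : g n ≤ 1 := (div_le_one (by positivity)).2 (by linarith)
  calc ∑ i ∈ Finset.range n, min (y * ρ ^ i) (y * ρ ^ i)⁻¹
      ≤ ∑ i ∈ Finset.range n, 4 * (ρ / (ρ - 1)) * (g (i + 1) - g i) :=
        Finset.sum_le_sum fun i _ => hterm i
    _ = 4 * (ρ / (ρ - 1)) * (g n - g 0) := by rw [← Finset.mul_sum, Finset.sum_range_sub]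
    _ ≤ 4 * (ρ / (ρ - 1)) := mul_le_of_le_one_right (by positivity) (by linarith)

/-- The sum `∑ j ≥ 0, 2 ^ (-p j)` of the geometric series of the dyadic scales, for `p > 0`. -/
def dyadicConst (p : ℝ) : ℝ := 2 ^ p / (2 ^ p - 1)

theorem dyadicConst_pos {p : ℝ} (hp : 0 < p) : 0 < dyadicConst p :=
  div_pos (by positivity) (sub_pos.2 (Real.one_lt_rpow one_lt_two hp))

theorem two_pow_div_rpow {H : ℝ} (hH : 0 < H) (p : ℝ) (j : ℕ) :
    ((2 : ℝ) ^ j / H) ^ p = (H ^ p)⁻¹ * (2 ^ p) ^ j := by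
  rw [Real.div_rpow (by positivity) hH.le, ← Real.rpow_pow_comm zero_le_two, inv_mul_eq_div]

theorem sum_min_inv_dyadic_rpow_le {H p : ℝ} (hH : 0 < H) (hp : 0 < p) (n : ℕ) :
    ∑ i ∈ Finset.range n, min (((2 : ℝ) ^ i / H) ^ p) (((2 : ℝ) ^ i / H) ^ p)⁻¹
      ≤ 4 * dyadicConst p := by
  simp only [two_pow_div_rpow hH]
  exact sum_min_inv_geom_le (Real.one_lt_rpow one_lt_two hp) (by positivity) n

theorem sum_dyadic_rpow_le {H p : ℝ} (hH : 0 < H) (hp : 0 < p) {n : ℕ} (hn : n ≠ 0) :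
    ∑ j ∈ Finset.range (Nat.log 2 n + 1), ((2 : ℝ) ^ j / H) ^ p ≤ dyadicConst p * (n / H) ^ p := by
  have hρ : 0 < (2 : ℝ) ^ p - 1 := sub_pos.2 (Real.one_lt_rpow one_lt_two hp)
  have hlog : (2 : ℝ) ^ Nat.log 2 n ≤ n := by exact_mod_cast Nat.pow_log_le_self 2 hn
  have hgeom : ∑ j ∈ Finset.range (Nat.log 2 n + 1), ((2 : ℝ) ^ p) ^ j
      ≤ dyadicConst p * (2 ^ p) ^ Nat.log 2 n := by
    rw [geom_sum_eq (by linarith), dyadicConst, div_mul_eq_mul_div, pow_succ']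
    gcongr
    linarith
  calc ∑ j ∈ Finset.range (Nat.log 2 n + 1), ((2 : ℝ) ^ j / H) ^ p
      ≤ (H ^ p)⁻¹ * (dyadicConst p * (2 ^ p) ^ Nat.log 2 n) := by
        simp only [two_pow_div_rpow hH, ← Finset.mul_sum]
        gcongr
    _ = dyadicConst p * (2 ^ Nat.log 2 n / H) ^ p := by rw [two_pow_div_rpow hH]; ring
    _ ≤ dyadicConst p * (n / H) ^ p := by
        have := dyadicConst_pos hp
        gcongr

theorem sum_rpow_sub_one_le {p : ℝ} (hp : 0 < p) (hp1 : p ≤ 1) (N : ℕ) :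
    ∑ j ∈ Finset.range N, (j + 1 : ℝ) ^ (p - 1) ≤ (N : ℝ) ^ p / p := by
  induction N with
  | zero => simp [hp.ne']
  | succ N ih =>
    have hN : (0 : ℝ) < N + 1 := by positivity
    have hbernoulli : (N : ℝ) ^ p ≤ (N + 1 : ℝ) ^ p - p * (N + 1 : ℝ) ^ (p - 1) := by
      have h : (1 + -(N + 1 : ℝ)⁻¹) ^ p ≤ 1 + p * -(N + 1 : ℝ)⁻¹ :=
        rpow_one_add_le_one_add_mul_self
          (neg_le_neg (inv_le_one_of_one_le₀ (by linarith [N.cast_nonneg (α := ℝ)]))) hp.le hp1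
      calc (N : ℝ) ^ p = (N + 1 : ℝ) ^ p * (1 + -(N + 1 : ℝ)⁻¹) ^ p := by
            rw [← Real.mul_rpow hN.le (by field_simp; simp)]
            congr 1
            field_simp
            ring
        _ ≤ (N + 1 : ℝ) ^ p * (1 + p * -(N + 1 : ℝ)⁻¹) := by gcongr
        _ = (N + 1 : ℝ) ^ p - p * (N + 1 : ℝ) ^ (p - 1) := by
            rw [Real.rpow_sub_one hN.ne']
            ring
    rw [Finset.sum_range_succ, le_div_iff₀ hp]
    rw [le_div_iff₀ hp] at ih
    push_cast
    linarith

theorem div_rpow_div_self_le {H m n p : ℝ} (hH : 0 < H) (hm : 0 < m) (hmn : m ≤ 2 * n)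
    (hp : 0 ≤ p) (hp1 : p ≤ 1) : (n / H) ^ p / n ≤ 2 * (H ^ p)⁻¹ * m ^ (p - 1) := by
  have hn : 0 < n := by linarith
  have h : (2 * n) ^ (p - 1) ≤ m ^ (p - 1) :=
    Real.rpow_le_rpow_of_nonpos hm hmn (by linarith)
  have h2 : 1 ≤ 2 * (2 : ℝ) ^ (p - 1) := by
    rw [Real.rpow_sub_one two_ne_zero, mul_div_cancel₀ _ two_ne_zero]
    exact Real.one_le_rpow one_le_two hp
  calc (n / H) ^ p / n = (H ^ p)⁻¹ * n ^ (p - 1) := by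
        rw [Real.div_rpow hn.le hH.le, Real.rpow_sub_one hn.ne']
        field_simp
    _ ≤ (H ^ p)⁻¹ * ((2 * 2 ^ (p - 1)) * n ^ (p - 1)) := by
        gcongr
        exact le_mul_of_one_le_left (by positivity) h2
    _ = 2 * (H ^ p)⁻¹ * (2 * n) ^ (p - 1) := by
        rw [Real.mul_rpow zero_le_two hn.le]
        ring
    _ ≤ 2 * (H ^ p)⁻¹ * m ^ (p - 1) := by gcongr

theorem rpow_mul_rpow_le_one_add {u v p q : ℝ} (hu : 0 ≤ u) (hv : 0 ≤ v) (hp : 0 ≤ p) (hq : 0 ≤ q)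
    (hpq : p + q ≤ 1) : u ^ p * v ^ q ≤ 1 + u + v := by
  calc u ^ p * v ^ q ≤ (1 + u + v) ^ p * (1 + u + v) ^ q := by
        gcongr <;> linarith
    _ = (1 + u + v) ^ (p + q) := (Real.rpow_add (by linarith) _ _).symm
    _ ≤ 1 + u + v := Real.rpow_le_self_of_one_le (by linarith) hpq

theorem pow_two_mul_le_exp_add_exp_neg (x : ℝ) (m : ℕ) :
    x ^ (2 * m) ≤ (2 * m).factorial * (Real.exp x + Real.exp (-x)) := by
  have h := Real.pow_div_factorial_le_exp |x| (abs_nonneg x) (2 * m)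
  rw [div_le_iff₀ (by positivity), (even_two_mul m).pow_abs,
    mul_comm (Real.exp |x|)] at h
  refine h.trans (mul_le_mul_of_nonneg_left ?_ (by positivity))
  rcases abs_choice x with hx | hx <;> rw [hx] <;> linarith [Real.exp_pos x, Real.exp_pos (-x)]

theorem lintegral_ofReal_sum {α ι : Type*} [MeasurableSpace α] {μ : Measure α} (s : Finset ι)
    {f : ι → α → ℝ} (hf : ∀ i ∈ s, Measurable (f i)) (hf0 : ∀ i ∈ s, ∀ x, 0 ≤ f i x) :
    ∫⁻ x, ENNReal.ofReal (∑ i ∈ s, f i x) ∂μ = ∑ i ∈ s, ∫⁻ x, ENNReal.ofReal (f i x) ∂μ := by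
  rw [← lintegral_finsetSum _ fun i hi => (hf i hi).ennreal_ofReal]
  exact lintegral_congr fun x => ENNReal.ofReal_sum_of_nonneg fun i hi => hf0 i hi x

theorem dist_le_of_dist_dyadic_le {E : Type*} [PseudoMetricSpace E] {J : ℕ} {f : ℕ → E} {D : ℕ → ℝ}
    (h : ∀ j < J, ∀ i, dist (f (i * 2 ^ j)) (f ((i + 1) * 2 ^ j)) ≤ D j) {m l : ℕ} (hml : m ≤ l)
    (hlm : l < m + 2 ^ J) : dist (f m) (f l) ≤ 2 * ∑ j ∈ Finset.range J, D j := by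
  induction J generalizing f D m l with
  | zero => simp [show l = m by omega]
  | succ J ih =>
    have h0 : ∀ i, dist (f i) (f (i + 1)) ≤ D 0 := by simpa using h 0 J.succ_pos
    have hD : 0 ≤ ∑ j ∈ Finset.range (J + 1), D j := Finset.sum_nonneg fun j hj =>
      dist_nonneg.trans (h j (Finset.mem_range.1 hj) 0)
    have hfine : ∀ i i', i ≤ i' → i' ≤ i + 1 → dist (f i) (f i') ≤ D 0 := by
      intro i i' h1 h2
      obtain rfl | rfl : i' = i ∨ i' = i + 1 := by omega
      · simpa using dist_nonneg.trans (h0 i')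
      · exact h0 i
    rcases le_or_gt (2 * ((m + 1) / 2)) (2 * (l / 2)) with hc | hc
    · have hcoarse : dist (f (2 * ((m + 1) / 2))) (f (2 * (l / 2)))
          ≤ 2 * ∑ j ∈ Finset.range J, D (j + 1) := by
        refine ih (f := fun i => f (2 * i)) (fun j hj i => ?_) (by omega)
          (by rw [pow_succ] at hlm; omega)
        have := h (j + 1) (by omega) i
        rw [pow_succ', mul_left_comm i, mul_left_comm (i + 1)] at this
        exact this
      rw [Finset.sum_range_succ']
      linarith [dist_triangle4 (f m) (f (2 * ((m + 1) / 2))) (f (2 * (l / 2))) (f l),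
        hfine m (2 * ((m + 1) / 2)) (by omega) (by omega),
        hfine (2 * (l / 2)) l (by omega) (by omega)]
    · rw [show l = m by omega, dist_self]
      exact mul_nonneg zero_le_two hD

/-! ### Counting the selections of an arm -/

section Picks

variable {α : Type*} [DecidableEq α] (φ : ℕ → α) (k : α)

/-- The rounds in `[u, v)` in which the sequence `φ` of selected arms takes the value `k`. -/
def picks (u v : ℕ) : Finset ℕ := {s ∈ Finset.Ico u v | φ s = k}

/-- The number of selections of arm `k` in the rounds `[u, v)`. -/
def pulls (u v : ℕ) : ℕ := (picks φ k u v).card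

/-- The selections of arm `k` in the rounds `[u, v)`, restricted to those with a number in `[a, b)`
when the selections of `k` from round `u` on are numbered from `0`. -/
def block (u v a b : ℕ) : Finset ℕ :=
  {s ∈ Finset.Ico u v | φ s = k ∧ a ≤ pulls φ k u s ∧ pulls φ k u s < b}

variable {φ k} {u v w t a b c : ℕ}

theorem mem_picks {s : ℕ} : s ∈ picks φ k u v ↔ (u ≤ s ∧ s < v) ∧ φ s = k := by
  simp [picks]

theorem mem_block {s : ℕ} : s ∈ block φ k u v a b ↔
    (u ≤ s ∧ s < v) ∧ φ s = k ∧ a ≤ pulls φ k u s ∧ pulls φ k u s < b := by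
  simp [block]

theorem pulls_add (huv : u ≤ v) (hvw : v ≤ w) :
    pulls φ k u v + pulls φ k v w = pulls φ k u w := by
  rw [pulls, pulls, pulls, picks, picks, picks, ← Finset.Ico_union_Ico_eq_Ico huv hvw,
    Finset.filter_union, Finset.card_union_of_disjoint]
  exact Finset.disjoint_filter_filter (Finset.Ico_disjoint_Ico_consecutive u v w)

theorem pulls_mono_right (hvw : v ≤ w) : pulls φ k u v ≤ pulls φ k u w :=
  Finset.card_le_card fun s hs => by
    obtain ⟨⟨hus, hsv⟩, hk⟩ := mem_picks.1 hs
    exact mem_picks.2 ⟨⟨hus, hsv.trans_le hvw⟩, hk⟩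

theorem pulls_anti_left (huv : u ≤ v) : pulls φ k v w ≤ pulls φ k u w :=
  Finset.card_le_card fun s hs => by
    obtain ⟨⟨hvs, hsw⟩, hk⟩ := mem_picks.1 hs
    exact mem_picks.2 ⟨⟨huv.trans hvs, hsw⟩, hk⟩

theorem pulls_le (φ : ℕ → α) (k : α) (u v : ℕ) : pulls φ k u v ≤ v - u :=
  (Finset.card_filter_le _ _).trans (Nat.card_Ico u v).le

theorem picks_succ (huv : u ≤ v) :
    picks φ k u (v + 1) = if φ v = k then insert v (picks φ k u v) else picks φ k u v := by
  rw [picks, ← Finset.insert_Ico_right_eq_Ico_add_one huv, Finset.filter_insert, picks]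

theorem pulls_succ (huv : u ≤ v) :
    pulls φ k u (v + 1) = pulls φ k u v + if φ v = k then 1 else 0 := by
  have hv : v ∉ picks φ k u v := by simp [mem_picks]
  rw [pulls, picks_succ huv]
  split_ifs with h
  · rw [Finset.card_insert_of_notMem hv, pulls]
  · rw [add_zero, pulls]

theorem pulls_lt (hut : u ≤ t) (htv : t < v) (ht : φ t = k) : pulls φ k u t < pulls φ k u v := by
  have h := pulls_succ (φ := φ) (k := k) hut
  rw [if_pos ht] at h
  have := pulls_mono_right (φ := φ) (k := k) (u := u) (show t + 1 ≤ v from htv)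
  omega

theorem sum_comp_pulls {M : Type*} [AddCommMonoid M] (G : ℕ → M) (huv : u ≤ v) :
    ∑ s ∈ picks φ k u v, G (pulls φ k u s) = ∑ j ∈ Finset.range (pulls φ k u v), G j := by
  induction v, huv using Nat.le_induction with
  | base => simp [picks, pulls]
  | succ v huv ih =>
    rw [picks_succ huv, pulls_succ huv]
    split_ifs
    · rw [Finset.sum_insert (by simp [mem_picks]), ih, Finset.sum_range_succ, add_comm]
    · exact ih

theorem sum_pulls [Fintype α] (φ : ℕ → α) (u v : ℕ) : ∑ k, pulls φ k u v = v - u := by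
  simpa [pulls, picks] using
    (Finset.card_eq_sum_card_fiberwise (s := Finset.Ico u v) (f := φ) (t := Finset.univ)
      fun _ _ => Finset.mem_coe.2 (Finset.mem_univ _)).symm

theorem sum_Ico_eq_sum_picks [Fintype α] {M : Type*} [AddCommMonoid M] (φ : ℕ → α)
    (g : α → ℕ → M) (u v : ℕ) :
    ∑ t ∈ Finset.Ico u v, g (φ t) t = ∑ k, ∑ t ∈ picks φ k u v, g k t := by
  rw [← Finset.sum_fiberwise (Finset.Ico u v) φ]
  refine Finset.sum_congr rfl fun k _ => Finset.sum_congr rfl fun t ht => ?_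
  rw [(Finset.mem_filter.1 ht).2]

theorem card_block_le (φ : ℕ → α) (k : α) (u v a b : ℕ) : (block φ k u v a b).card ≤ b - a := by
  rw [← Nat.card_Ico a b]
  refine Finset.card_le_card_of_injOn (pulls φ k u) (fun s hs => ?_) fun s hs s' hs' h => ?_
  · have := mem_block.1 hs
    simpa using this.2.2
  · have hs := mem_block.1 hs
    have hs' := mem_block.1 hs'
    rcases lt_trichotomy s s' with hlt | heq | hlt
    · exact absurd h (pulls_lt hs.1.1 hlt hs.2.1).ne
    · exact heq
    · exact absurd h (pulls_lt hs'.1.1 hlt hs'.2.1).ne'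

theorem block_eq_empty (h : pulls φ k u v ≤ a) : block φ k u v a b = ∅ := by
  refine Finset.eq_empty_of_forall_notMem fun s hs => ?_
  obtain ⟨⟨hus, hsv⟩, hk, has, -⟩ := mem_block.1 hs
  have := pulls_lt hus hsv hk
  omega

theorem sum_block_add {M : Type*} [AddCommMonoid M] (x : ℕ → M) (hab : a ≤ b) (hbc : b ≤ c) :
    ∑ s ∈ block φ k u v a b, x s + ∑ s ∈ block φ k u v b c, x s
      = ∑ s ∈ block φ k u v a c, x s := by
  have hdisj : Disjoint (block φ k u v a b) (block φ k u v b c) :=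
    Finset.disjoint_left.2 fun s hs hs' => by
      rw [mem_block] at hs hs'
      omega
  rw [← Finset.sum_union hdisj]
  congr 1
  ext s
  simp only [Finset.mem_union, mem_block]
  grind

theorem block_pulls_pulls (huw : u ≤ w) (htv : t ≤ v) :
    block φ k u v (pulls φ k u w) (pulls φ k u t) = picks φ k w t := by
  ext s
  simp only [mem_block, mem_picks]
  constructor
  · rintro ⟨⟨hus, -⟩, hk, h1, h2⟩
    refine ⟨⟨?_, ?_⟩, hk⟩
    · by_contra! hlt
      exact (pulls_lt hus hlt hk).not_ge h1
    · by_contra! hle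
      exact (pulls_mono_right hle).not_gt h2
  · rintro ⟨⟨hws, hst⟩, hk⟩
    exact ⟨⟨huw.trans hws, hst.trans_le htv⟩, hk, pulls_mono_right hws,
      pulls_lt (huw.trans hws) hst hk⟩

theorem card_picks_pulls_eq_zero_le_one {τ : ℕ} (hv : v ≤ w + τ) :
    {s ∈ picks φ k w v | pulls φ k (s - τ) s = 0}.card ≤ 1 := by
  have h : ∀ s ∈ picks φ k w v, ∀ s' ∈ picks φ k w v, pulls φ k (s' - τ) s' = 0 → s' ≤ s := by
    intro s hs s' hs' h0
    obtain ⟨⟨hws, -⟩, hk⟩ := mem_picks.1 hs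
    obtain ⟨⟨-, hsv⟩, -⟩ := mem_picks.1 hs'
    by_contra! hlt
    have := pulls_lt (u := s' - τ) (by omega) hlt hk
    omega
  refine Finset.card_le_one.2 fun s hs s' hs' => ?_
  rw [Finset.mem_filter] at hs hs'
  exact (h s' hs'.1 s hs.1 hs.2).antisymm (h s hs.1 s' hs'.1 hs'.2)

end Picks

/-- The first round of the `i`-th epoch when the rounds before `T` are cut into epochs of length
`τ`, the last one of which may be shorter; it is `T` for all larger `i`. -/
def epochStart (τ T i : ℕ) : ℕ := min (i * τ) T

theorem epochStart_succ_le (τ T i : ℕ) : epochStart τ T (i + 1) ≤ epochStart τ T i + τ := by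
  rw [epochStart, epochStart, add_one_mul]
  omega

theorem epochStart_mono (τ T : ℕ) : Monotone (epochStart τ T) := fun _ _ h =>
  min_le_min_right T (Nat.mul_le_mul_right τ h)

theorem sum_range_epochStart {M : Type*} [AddCommMonoid M] (g : ℕ → M) (τ T m : ℕ) :
    ∑ t ∈ Finset.range (epochStart τ T m), g t
      = ∑ i ∈ Finset.range m,
          ∑ t ∈ Finset.Ico (epochStart τ T i) (epochStart τ T (i + 1)), g t := by
  induction m with
  | zero => simp [epochStart]
  | succ m ih =>
    rw [Finset.sum_range_succ, ← ih, Finset.range_eq_Ico, Finset.range_eq_Ico]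
    exact (Finset.sum_Ico_consecutive g (Nat.zero_le _) (epochStart_mono τ T m.le_succ)).symm

/-! ### Chaining over dyadic blocks of selections -/

/-- The weight, in `chainEnergy`, of the blocks of `z H` selections. It decays in both directions
so that the expected energy is a convergent sum over the scales `z`, while `z ^ 4 * chainWeight z`,
the weight relative to the eighth moment of a block, still bounds each block sum. -/
def chainWeight (z : ℝ) : ℝ := min (z ^ 2)⁻¹ (z ^ 6)⁻¹

theorem chainWeight_pos {z : ℝ} (hz : 0 < z) : 0 < chainWeight z :=
  lt_min (by positivity) (by positivity)

theorem chainWeight_mul_pow_le {z : ℝ} (hz : 0 < z) {m : ℕ} (hm : 3 ≤ m) (hm' : m ≤ 5) :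
    chainWeight z * z ^ m ≤ min z z⁻¹ := by
  rcases le_total z 1 with h | h
  · have hzinv : z ≤ z⁻¹ := h.trans (one_le_inv₀ hz |>.2 h)
    calc chainWeight z * z ^ m ≤ (z ^ 2)⁻¹ * z ^ 3 :=
          mul_le_mul (min_le_left _ _) (pow_le_pow_of_le_one hz.le h hm) (by positivity)
            (by positivity)
      _ = z := by field_simp
      _ = min z z⁻¹ := (min_eq_left hzinv).symm
  · have hzinv : z⁻¹ ≤ z := (inv_le_one_of_one_le₀ h).trans h
    calc chainWeight z * z ^ m ≤ (z ^ 6)⁻¹ * z ^ 5 :=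
          mul_le_mul (min_le_right _ _) (pow_le_pow_right₀ h hm') (by positivity) (by positivity)
      _ = z⁻¹ := by field_simp
      _ = min z z⁻¹ := (min_eq_right hzinv).symm

theorem abs_le_of_chainWeight_mul_pow_le {X Q H z : ℝ} (hQ : 0 ≤ Q) (hH : 0 < H) (hz : 0 < z)
    (hX : chainWeight z / H ^ 4 * X ^ 8 ≤ Q) :
    |X| ≤ √H * Q ^ (1 / 8 : ℝ) * (z ^ (1 / 4 : ℝ) + z ^ (3 / 4 : ℝ)) := by
  set y := z ^ (1 / 4 : ℝ) with hy
  have hy0 : 0 < y := by positivity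
  have hyz : y ^ 4 = z := by rw [hy, ← Real.rpow_mul_natCast hz.le]; norm_num
  have hyz3 : z ^ (3 / 4 : ℝ) = y ^ 3 := by rw [hy, ← Real.rpow_mul_natCast hz.le]; norm_num
  have hQ8 : (Q ^ (1 / 8 : ℝ)) ^ 8 = Q := by rw [← Real.rpow_mul_natCast hQ]; norm_num
  have hH8 : √H ^ 8 = H ^ 4 := by rw [show 8 = 2 * 4 from rfl, pow_mul, Real.sq_sqrt hH.le]
  have hweight : 1 ≤ chainWeight z * (y + y ^ 3) ^ 8 := by
    rw [chainWeight, min_mul_of_nonneg _ _ (by positivity), ← hyz]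
    refine le_min ?_ ?_ <;> rw [inv_mul_eq_div, one_le_div₀ (by positivity), ← pow_mul]
    · exact pow_le_pow_left₀ hy0.le (le_add_of_nonneg_right (by positivity)) 8
    · rw [show 4 * 6 = 3 * 8 from rfl, pow_mul]
      exact pow_le_pow_left₀ (by positivity) (le_add_of_nonneg_left hy0.le) 8
  rw [hyz3]
  refine le_of_pow_le_pow_left₀ (n := 8) (by norm_num) (by positivity) ?_
  rw [Even.pow_abs (by decide), mul_pow, mul_pow, hQ8, hH8]
  calc X ^ 8 ≤ X ^ 8 * (chainWeight z * (y + y ^ 3) ^ 8) :=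
        le_mul_of_one_le_right (Even.pow_nonneg (by decide) X) hweight
    _ = H ^ 4 * (chainWeight z / H ^ 4 * X ^ 8) * (y + y ^ 3) ^ 8 := by field_simp
    _ ≤ H ^ 4 * Q * (y + y ^ 3) ^ 8 := by gcongr

section Chaining

variable {α : Type*} [DecidableEq α]

/-- The weighted sum of the eighth powers of all dyadic block sums of `x` over the selections of
arm `k` in the rounds `[u, v)`. The parameter `H` is the number of selections at which the noise of
an average balances its bonus. -/
def chainEnergy (φ : ℕ → α) (x : ℕ → ℝ) (k : α) (u v : ℕ) (H : ℝ) : ℝ :=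
  ∑ j ∈ Finset.range v, ∑ i ∈ Finset.range v, chainWeight (2 ^ j / H) / H ^ 4 *
    (∑ s ∈ block φ k u v (i * 2 ^ j) ((i + 1) * 2 ^ j), x s) ^ 8

/-- The constant lost by the chaining over the dyadic scales in `abs_sum_picks_le`. -/
def chainConst : ℝ := 2 * (dyadicConst (1 / 4) + dyadicConst (3 / 4))

theorem chainConst_pos : 0 < chainConst :=
  mul_pos two_pos (add_pos (dyadicConst_pos (by norm_num)) (dyadicConst_pos (by norm_num)))

variable {φ : ℕ → α} {x : ℕ → ℝ} {k : α} {u v w t : ℕ} {H : ℝ}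

theorem chainEnergy_summand_nonneg (hH : 0 < H) (X : ℝ) (j : ℕ) :
    0 ≤ chainWeight (2 ^ j / H) / H ^ 4 * X ^ 8 :=
  mul_nonneg (div_nonneg (chainWeight_pos (by positivity)).le (by positivity))
    (Even.pow_nonneg (by decide) X)

theorem chainEnergy_nonneg (hH : 0 < H) : 0 ≤ chainEnergy φ x k u v H :=
  Finset.sum_nonneg fun j _ => Finset.sum_nonneg fun _ _ => chainEnergy_summand_nonneg hH _ j

theorem abs_sum_dyadic_block_le (hH : 0 < H) {j : ℕ} (hj : j < v) (i : ℕ) :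
    |∑ s ∈ block φ k u v (i * 2 ^ j) ((i + 1) * 2 ^ j), x s|
      ≤ √H * chainEnergy φ x k u v H ^ (1 / 8 : ℝ)
        * ((2 ^ j / H) ^ (1 / 4 : ℝ) + (2 ^ j / H) ^ (3 / 4 : ℝ)) := by
  have hQ : 0 ≤ chainEnergy φ x k u v H := chainEnergy_nonneg hH
  by_cases hi : i < v
  · refine abs_le_of_chainWeight_mul_pow_le hQ hH (by positivity) ?_
    rw [chainEnergy]
    refine le_trans ?_ (Finset.single_le_sum (fun j _ => Finset.sum_nonneg fun _ _ =>
      chainEnergy_summand_nonneg hH _ j) (Finset.mem_range.2 hj))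
    exact Finset.single_le_sum (f := fun i => chainWeight (2 ^ j / H) / H ^ 4 *
      (∑ s ∈ block φ k u v (i * 2 ^ j) ((i + 1) * 2 ^ j), x s) ^ 8)
      (fun _ _ => chainEnergy_summand_nonneg hH _ j) (Finset.mem_range.2 hi)
  · have hpulls : pulls φ k u v ≤ i * 2 ^ j :=
      calc pulls φ k u v ≤ v - u := pulls_le φ k u v
        _ ≤ i := by omega
        _ ≤ i * 2 ^ j := Nat.le_mul_of_pos_right i (by positivity)
    rw [block_eq_empty hpulls, Finset.sum_empty, abs_zero]
    positivity

theorem dist_sum_block {a b : ℕ} (hab : a ≤ b) :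
    dist (∑ s ∈ block φ k u v 0 a, x s) (∑ s ∈ block φ k u v 0 b, x s)
      = |∑ s ∈ block φ k u v a b, x s| := by
  rw [← sum_block_add x a.zero_le hab, dist_self_add_right, Real.norm_eq_abs]

theorem abs_sum_picks_le (huw : u ≤ w) (hwt : w ≤ t) (htv : t ≤ v) (hH : 0 < H) :
    |∑ s ∈ picks φ k w t, x s| ≤ √H * chainEnergy φ x k u v H ^ (1 / 8 : ℝ) *
      (chainConst *
        ((pulls φ k w t / H) ^ (1 / 4 : ℝ) + (pulls φ k w t / H) ^ (3 / 4 : ℝ))) := by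
  have hQ : 0 ≤ chainEnergy φ x k u v H := chainEnergy_nonneg hH
  have hc := chainConst_pos
  rcases eq_or_ne (pulls φ k w t) 0 with hn | hn
  · rw [Finset.card_eq_zero.1 hn, Finset.sum_empty, abs_zero]
    positivity
  set n := pulls φ k w t
  set B := √H * chainEnergy φ x k u v H ^ (1 / 8 : ℝ)
  have hlog : Nat.log 2 n + 1 ≤ v := calc
    Nat.log 2 n + 1 ≤ n := Nat.log_lt_self 2 hn
    _ ≤ t - w := pulls_le φ k w t
    _ ≤ v := by omega
  have hlt : pulls φ k u t < pulls φ k u w + 2 ^ (Nat.log 2 n + 1) := by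
    rw [← pulls_add huw hwt]
    exact Nat.add_lt_add_left (Nat.lt_pow_succ_log_self one_lt_two n) _
  have hchain := dist_le_of_dist_dyadic_le (f := fun a => ∑ s ∈ block φ k u v 0 a, x s)
    (D := fun j => B * ((2 ^ j / H) ^ (1 / 4 : ℝ) + (2 ^ j / H) ^ (3 / 4 : ℝ)))
    (fun j hj i => (dist_sum_block (Nat.mul_le_mul_right _ i.le_succ)).trans_le
      (abs_sum_dyadic_block_le hH (by omega) i)) (pulls_mono_right hwt) hlt
  rw [dist_sum_block (pulls_mono_right hwt), block_pulls_pulls huw htv, ← Finset.mul_sum,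
    Finset.sum_add_distrib, mul_left_comm] at hchain
  refine hchain.trans (mul_le_mul_of_nonneg_left ?_ (by positivity))
  have hsum1 := sum_dyadic_rpow_le hH (by norm_num : (0 : ℝ) < 1 / 4) hn
  have hsum3 := sum_dyadic_rpow_le hH (by norm_num : (0 : ℝ) < 3 / 4) hn
  have hd1 := dyadicConst_pos (by norm_num : (0 : ℝ) < 1 / 4)
  have hd3 := dyadicConst_pos (by norm_num : (0 : ℝ) < 3 / 4)
  have hcross : 0 ≤ dyadicConst (1 / 4) * (n / H) ^ (3 / 4 : ℝ)
    + dyadicConst (3 / 4) * (n / H) ^ (1 / 4 : ℝ) := by positivity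
  rw [chainConst]
  linarith

end Chaining

/-! ### Errors of the index -/

/-- The exploration bonus of an arm with `n` samples in the window. At the sample number `H`, which
is `τ / K` for SW-MOSS, it vanishes. -/
def bonus (η H n : ℝ) : ℝ := √(η * (max (Real.log (H / n)) 0 / n))

theorem bonus_le {η H n : ℝ} (hη : 0 ≤ η) (hH : 0 < H) (hn : 0 ≤ n) :
    bonus η H n ≤ √(2 * η) * √H * ((n / H) ^ (1 / 4 : ℝ) / n) := by
  rcases hn.eq_or_lt with rfl | hn
  · simp [bonus]
  set y := (n / H) ^ (1 / 4 : ℝ) with hy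
  have hy0 : 0 < y := by positivity
  have hy4 : y ^ 4 = n / H := by rw [hy, ← Real.rpow_mul_natCast (by positivity)]; norm_num
  have hlog : max (Real.log (H / n)) 0 ≤ 2 * (y ^ 2)⁻¹ := by
    refine max_le ?_ (by positivity)
    rw [show H / n = ((y ^ 2)⁻¹) ^ 2 by rw [inv_pow, ← pow_mul, hy4, inv_div], Real.log_pow]
    have := Real.log_le_sub_one_of_pos (by positivity : 0 < (y ^ 2)⁻¹)
    push_cast
    linarith
  refine Real.sqrt_le_iff.2 ⟨by positivity, ?_⟩
  calc η * (max (Real.log (H / n)) 0 / n) ≤ η * (2 * (y ^ 2)⁻¹ / n) := by gcongr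
    _ = 2 * η * H * (n / H) * (y ^ 2)⁻¹ / n ^ 2 := by field_simp
    _ = 2 * η * H * y ^ 2 / n ^ 2 := by rw [← hy4]; field_simp
    _ = (√(2 * η) * √H * (y / n)) ^ 2 := by
        rw [mul_pow, mul_pow, Real.sq_sqrt (by positivity), Real.sq_sqrt hH.le, div_pow]
        ring

section IndexErrors

variable {α : Type*} [DecidableEq α]

/-- How far the index of arm `k` in round `t` falls below its mean if `x` is the noise of the
rewards and the window begins in round `u`. Without a sample it is `0` by the convention
`z / 0 = 0`. -/
def shortfall (φ : ℕ → α) (x : ℕ → ℝ) (η H : ℝ) (k : α) (u t : ℕ) : ℝ :=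
  max 0 (-((∑ s ∈ picks φ k u t, x s) / pulls φ k u t + bonus η H (pulls φ k u t)))

/-- A bound on how far the index of arm `k` in round `t` exceeds its mean if `x` is the noise of
the rewards and the window begins in round `u`. Without a sample it is `0` by the convention
`z / 0 = 0`. -/
def excess (φ : ℕ → α) (x : ℕ → ℝ) (η H : ℝ) (k : α) (u t : ℕ) : ℝ :=
  |∑ s ∈ picks φ k u t, x s| / pulls φ k u t + bonus η H (pulls φ k u t)

variable {φ : ℕ → α} {x : ℕ → ℝ} {k : α} {u v w t τ : ℕ} {η H : ℝ}

theorem shortfall_nonneg : 0 ≤ shortfall φ x η H k u t := le_max_left _ _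

theorem excess_nonneg : 0 ≤ excess φ x η H k u t :=
  add_nonneg (by positivity) (Real.sqrt_nonneg _)

theorem sum_picks_rpow_div_le (hwv : w ≤ v) (hv : v ≤ w + τ) (hH : 0 < H) {p : ℝ} (hp : 0 < p)
    (hp1 : p ≤ 1) :
    ∑ t ∈ picks φ k w v, ((pulls φ k (t - τ) t : ℝ) / H) ^ p / pulls φ k (t - τ) t
      ≤ 2 / p * ((pulls φ k w v : ℝ) / H) ^ p := by
  have hterm : ∀ t ∈ picks φ k w v,
      ((pulls φ k (t - τ) t : ℝ) / H) ^ p / pulls φ k (t - τ) t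
        ≤ 2 * (H ^ p)⁻¹ * (pulls φ k w t + 1 : ℝ) ^ (p - 1) := by
    intro t ht
    obtain ⟨⟨-, htv⟩, -⟩ := mem_picks.1 ht
    rcases eq_or_ne (pulls φ k (t - τ) t) 0 with h0 | h0
    · rw [h0, Nat.cast_zero, div_zero]
      positivity
    refine div_rpow_div_self_le hH (by positivity) ?_ hp.le hp1
    have hle : pulls φ k w t ≤ pulls φ k (t - τ) t := pulls_anti_left (by omega)
    exact_mod_cast (by omega : pulls φ k w t + 1 ≤ 2 * pulls φ k (t - τ) t)
  calc _ ≤ ∑ t ∈ picks φ k w v, 2 * (H ^ p)⁻¹ * (pulls φ k w t + 1 : ℝ) ^ (p - 1) :=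
        Finset.sum_le_sum hterm
    _ = 2 * (H ^ p)⁻¹ * ∑ j ∈ Finset.range (pulls φ k w v), (j + 1 : ℝ) ^ (p - 1) := by
        rw [← Finset.mul_sum, sum_comp_pulls (fun j => (j + 1 : ℝ) ^ (p - 1)) hwv]
    _ ≤ 2 * (H ^ p)⁻¹ * ((pulls φ k w v : ℝ) ^ p / p) := by
        gcongr
        exact sum_rpow_sub_one_le hp hp1 _
    _ = 2 / p * ((pulls φ k w v : ℝ) / H) ^ p := by
        rw [Real.div_rpow (by positivity) hH.le]
        ring

theorem excess_le (hη : 0 ≤ η) (hH : 0 < H) (huw : u ≤ w) (hwt : w ≤ t) (htv : t ≤ v) :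
    excess φ x η H k w t ≤ √H * chainEnergy φ x k u v H ^ (1 / 8 : ℝ) * chainConst *
        ((pulls φ k w t / H) ^ (1 / 4 : ℝ) / pulls φ k w t
          + (pulls φ k w t / H) ^ (3 / 4 : ℝ) / pulls φ k w t)
      + √(2 * η) * √H * ((pulls φ k w t / H) ^ (1 / 4 : ℝ) / pulls φ k w t) := by
  rw [excess, ← add_div, ← mul_div_assoc, mul_assoc _ chainConst]
  gcongr
  · exact abs_sum_picks_le huw hwt htv hH
  · exact bonus_le hη hH (Nat.cast_nonneg _)

theorem sum_excess_le (hη : 0 ≤ η) (hH : 0 < H) (hwv : w ≤ v) (hv : v ≤ w + τ) :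
    ∑ t ∈ picks φ k w v, excess φ x η H k (t - τ) t ≤ 8 * (2 * chainConst + √(2 * η)) * √H *
      (1 + chainEnergy φ x k (w - τ) v H + pulls φ k w v / H) := by
  set Q := chainEnergy φ x k (w - τ) v H
  set X : ℝ := pulls φ k w v / H
  have hQ : 0 ≤ Q := chainEnergy_nonneg hH
  have hX : 0 ≤ X := by positivity
  have hc := chainConst_pos
  have hterm : ∀ t ∈ picks φ k w v, excess φ x η H k (t - τ) t ≤ _ := fun t ht =>
    have ht := (mem_picks.1 ht).1
    excess_le (u := w - τ) (v := v) hη hH (Nat.sub_le_sub_right ht.1 τ) (Nat.sub_le t τ) ht.2.le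
  have hsum1 := sum_picks_rpow_div_le (φ := φ) (k := k) hwv hv hH
    (by norm_num : (0 : ℝ) < 1 / 4) (by norm_num)
  have hsum3 := sum_picks_rpow_div_le (φ := φ) (k := k) hwv hv hH
    (by norm_num : (0 : ℝ) < 3 / 4) (by norm_num)
  have hQX1 := rpow_mul_rpow_le_one_add (p := 1 / 8) (q := 1 / 4) hQ hX (by norm_num) (by norm_num)
    (by norm_num)
  have hQX3 := rpow_mul_rpow_le_one_add (p := 1 / 8) (q := 3 / 4) hQ hX (by norm_num) (by norm_num)
    (by norm_num)
  have hX1 := rpow_mul_rpow_le_one_add (p := 0) (q := 1 / 4) hQ hX le_rfl (by norm_num)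
    (by norm_num)
  rw [Real.rpow_zero, one_mul] at hX1
  calc _ ≤ _ := Finset.sum_le_sum hterm
    _ ≤ √H * Q ^ (1 / 8 : ℝ) * chainConst *
          (2 / (1 / 4) * X ^ (1 / 4 : ℝ) + 2 / (3 / 4) * X ^ (3 / 4 : ℝ))
        + √(2 * η) * √H * (2 / (1 / 4) * X ^ (1 / 4 : ℝ)) := by
        rw [Finset.sum_add_distrib, ← Finset.mul_sum, ← Finset.mul_sum, Finset.sum_add_distrib]
        gcongr
    _ = √H * (chainConst * (8 * (Q ^ (1 / 8 : ℝ) * X ^ (1 / 4 : ℝ))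
          + 8 / 3 * (Q ^ (1 / 8 : ℝ) * X ^ (3 / 4 : ℝ))) + √(2 * η) * (8 * X ^ (1 / 4 : ℝ))) := by
        ring
    _ ≤ √H * (chainConst * (8 * (1 + Q + X) + 8 * (1 + Q + X)) + √(2 * η) * (8 * (1 + Q + X))) := by
        gcongr
        norm_num
    _ = 8 * (2 * chainConst + √(2 * η)) * √H * (1 + Q + X) := by ring

theorem sum_range_excess_le [Fintype α] (hη : 0 ≤ η) (hH : 0 < H) {m T : ℕ} (hm : T ≤ m * τ) :
    ∑ t ∈ Finset.range T, excess φ x η H (φ t) (t - τ) t ≤ ∑ i ∈ Finset.range m, ∑ k,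
      8 * (2 * chainConst + √(2 * η)) * √H *
        (chainEnergy φ x k (epochStart τ T i - τ) (epochStart τ T (i + 1)) H
          + (1 + pulls φ k (epochStart τ T i - τ) (epochStart τ T (i + 1)) / H)) := by
  have hT : epochStart τ T m = T := min_eq_right hm
  have hc := chainConst_pos
  conv_lhs => rw [← hT, sum_range_epochStart]
  refine Finset.sum_le_sum fun i _ => ?_
  have hwv := epochStart_mono τ T i.le_succ
  rw [sum_Ico_eq_sum_picks φ fun k t => excess φ x η H k (t - τ) t]
  refine Finset.sum_le_sum fun k _ =>
    (sum_excess_le hη hH hwv (epochStart_succ_le τ T i)).trans ?_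
  have hpulls : (pulls φ k (epochStart τ T i) (epochStart τ T (i + 1)) : ℝ) / H
      ≤ pulls φ k (epochStart τ T i - τ) (epochStart τ T (i + 1)) / H := by
    gcongr
    exact pulls_anti_left (Nat.sub_le _ τ)
  exact mul_le_mul_of_nonneg_left (by linarith) (by positivity)

end IndexErrors

/-! ### The law of the observations as a measure on infinite paths -/

variable {K : ℕ}

/-- An infinite sequence of observations. A history is turned into a path by `Hist.pad`, so that
the histories of all rounds live in one space. -/
abbrev Path (K : ℕ) : Type := ℕ → Fin K × ℝ

/-- The observations of a path before round `t`. -/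
def Path.take (ω : Path K) (t : ℕ) : Hist K t := fun s => ω s

/-- The sequence of selected arms of a path. -/
def Path.arm (ω : Path K) (s : ℕ) : Fin K := (ω s).1

/-- The deviation of the reward of round `s` from the mean of the selected arm. -/
def Env.noise (F : Env K) (ω : Path K) (s : ℕ) : ℝ := (ω s).2 - F.mean s (ω.arm s)

@[fun_prop]
theorem measurable_take (t : ℕ) : Measurable (fun ω : Path K => ω.take t) :=
  measurable_pi_lambda _ fun _ => measurable_pi_apply _

theorem take_update (ω : Path K) (p : Fin K × ℝ) {s t : ℕ} (hst : s ≤ t) :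
    Path.take (Function.update ω t p) s = ω.take s :=
  funext fun r => Function.update_of_ne (by omega) _ _

theorem arm_update_self (ω : Path K) (p : Fin K × ℝ) (t : ℕ) :
    Path.arm (Function.update ω t p) t = p.1 := by
  simp [Path.arm]

theorem arm_update_of_ne (ω : Path K) (p : Fin K × ℝ) {s t : ℕ} (hst : s ≠ t) :
    Path.arm (Function.update ω t p) s = ω.arm s := by
  simp [Path.arm, hst]

theorem noise_update_of_ne (F : Env K) (ω : Path K) (p : Fin K × ℝ) {s t : ℕ} (hst : s ≠ t) :
    F.noise (Function.update ω t p) s = F.noise ω s := by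
  simp [Env.noise, Path.arm, hst]

@[fun_prop]
theorem measurable_arm (s : ℕ) : Measurable (fun ω : Path K => ω.arm s) :=
  measurable_fst.comp (measurable_pi_apply s)

@[fun_prop]
theorem measurable_noise (F : Env K) (s : ℕ) : Measurable fun ω : Path K => F.noise ω s :=
  (measurable_snd.comp (measurable_pi_apply s)).sub
    ((measurable_of_finite (F.mean s)).comp (measurable_arm s))

theorem measurable_update_prod (t : ℕ) :
    Measurable fun q : Path K × (Fin K × ℝ) => Function.update q.1 t q.2 := by
  refine measurable_pi_lambda _ fun s => ?_
  rcases eq_or_ne s t with rfl | hs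
  · simpa using measurable_snd
  · simp only [Function.update_of_ne hs]
    exact (measurable_pi_apply s).comp measurable_fst

theorem measurable_snoc {t : ℕ} :
    Measurable (fun p : Hist K t × (Fin K × ℝ) => (Fin.snoc p.1 p.2 : Hist K (t + 1))) := by
  refine measurable_pi_lambda _ fun s => ?_
  refine Fin.lastCases ?_ (fun i => ?_) s
  · simpa using measurable_snd
  · simp only [Fin.snoc_castSucc]
    exact (measurable_pi_apply i).comp measurable_fst

instance (F : Env K) (t : ℕ) : IsMarkovKernel (F.rewardKernel t) :=
  ⟨fun k => inferInstanceAs (IsProbabilityMeasure (F t k : Measure ℝ))⟩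

instance (π : Policy K) (t : ℕ) : IsMarkovKernel (π.act t) := π.markov t

instance (π : Policy K) (F : Env K) (t : ℕ) : IsProbabilityMeasure (π.law F t) := by
  induction t with
  | zero => exact inferInstanceAs (IsProbabilityMeasure (Measure.dirac _))
  | succ t ih => exact Measure.isProbabilityMeasure_map measurable_snoc.aemeasurable

theorem measurable_act (π : Policy K) (t : ℕ) :
    Measurable fun ω : Path K => π.act t (ω.take t) {ω.arm t} :=
  (measurable_from_prod_countable_left (f := fun p : Hist K t × Fin K => π.act t p.1 {p.2})
    fun k => (π.act t).measurable_coe (measurableSet_singleton k)).comp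
    ((measurable_take t).prodMk (measurable_arm t))

section PathLaw

variable [NeZero K]

/-- The path that begins with the history `h` and continues with the reward `0` of arm `0`. -/
def Hist.pad {t : ℕ} (h : Hist K t) : Path K := fun s => if hs : s < t then h ⟨s, hs⟩ else (0, 0)

/-- The law of the observations of the first `T` rounds, as a measure on paths. -/
def Policy.pathLaw (π : Policy K) (F : Env K) (T : ℕ) : Measure (Path K) :=
  (π.law F T).map Hist.pad

theorem measurable_pad (t : ℕ) : Measurable (Hist.pad : Hist K t → Path K) := by
  refine measurable_pi_lambda _ fun s => ?_
  by_cases hs : s < t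
  · simpa [Hist.pad, hs] using measurable_pi_apply _
  · simp [Hist.pad, hs]

theorem take_pad {t : ℕ} (h : Hist K t) : h.pad.take t = h := by
  funext s
  simp [Path.take, Hist.pad]

theorem pad_snoc {t : ℕ} (h : Hist K t) (p : Fin K × ℝ) :
    Hist.pad (Fin.snoc h p : Hist K (t + 1)) = Function.update h.pad t p := by
  funext s
  rcases lt_trichotomy s t with hs | rfl | hs
  · simp [Hist.pad, Fin.snoc, hs, hs.ne, hs.trans t.lt_succ_self]
  · simp [Hist.pad, Fin.snoc]
  · simp [Hist.pad, hs.ne', hs.not_gt, (Nat.succ_le_of_lt hs).not_gt]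

instance (π : Policy K) (F : Env K) (T : ℕ) : IsProbabilityMeasure (π.pathLaw F T) :=
  Measure.isProbabilityMeasure_map (measurable_pad T).aemeasurable

theorem lintegral_pathLaw_succ (π : Policy K) (F : Env K) (t : ℕ) {f : Path K → ENNReal}
    (hf : Measurable f) :
    ∫⁻ ω, f ω ∂(π.pathLaw F (t + 1))
      = ∫⁻ ω, ∑ k, (∫⁻ x, f (Function.update ω t (k, x)) ∂(F t k : Measure ℝ))
          * π.act t (ω.take t) {k} ∂(π.pathLaw F t) := by
  have hpad : Measurable fun p : Hist K t × (Fin K × ℝ) =>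
      f (Hist.pad (Fin.snoc p.1 p.2 : Hist K (t + 1))) :=
    (hf.comp (measurable_pad (t + 1))).comp measurable_snoc
  have hreward : ∀ k, Measurable fun ω : Path K =>
      ∫⁻ x, f (Function.update ω t (k, x)) ∂(F t k : Measure ℝ) := fun k =>
    Measurable.lintegral_prod_right' (f := fun q : Path K × ℝ => f (Function.update q.1 t (k, q.2)))
      (hf.comp ((measurable_update_prod t).comp
        (measurable_fst.prodMk (measurable_const.prodMk measurable_snd))))
  have hact : ∀ k, Measurable fun ω : Path K => π.act t (ω.take t) {k} := fun k =>
    ((π.act t).measurable_coe (measurableSet_singleton k)).comp (measurable_take t)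
  calc ∫⁻ ω, f ω ∂(π.pathLaw F (t + 1))
      = ∫⁻ h, ∫⁻ p, f (Hist.pad (Fin.snoc h p : Hist K (t + 1)))
          ∂((π.act t ⊗ₖ Kernel.prodMkLeft (Hist K t) (F.rewardKernel t)) h) ∂(π.law F t) := by
        rw [Policy.pathLaw, lintegral_map hf (measurable_pad _), Policy.law,
          lintegral_map (f := fun h => f (Hist.pad h)) (hf.comp (measurable_pad _)) measurable_snoc]
        exact Measure.lintegral_compProd hpad
    _ = ∫⁻ h, ∑ k, (∫⁻ x, f (Function.update h.pad t (k, x)) ∂(F t k : Measure ℝ))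
          * π.act t (h.pad.take t) {k} ∂(π.law F t) := by
        refine lintegral_congr fun h => ?_
        rw [Kernel.lintegral_compProd (f := fun p => f (Hist.pad (Fin.snoc h p))) _ _ _
          (hpad.comp measurable_prodMk_left), lintegral_fintype]
        simp only [pad_snoc, take_pad]
        rfl
    _ = _ := by
        rw [Policy.pathLaw]
        exact (lintegral_map (Finset.measurable_fun_sum _ fun k _ => (hreward k).mul (hact k))
          (measurable_pad t)).symm

theorem ae_pathLaw_succ {π : Policy K} {F : Env K} {t : ℕ} {p : Path K → Prop}
    (hp : MeasurableSet {ω | p ω})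
    (h : ∀ᵐ ω : Path K ∂(π.pathLaw F t), ∀ k, π.act t (ω.take t) {k} ≠ 0 →
      ∀ x, p (Function.update ω t (k, x))) :
    ∀ᵐ ω ∂(π.pathLaw F (t + 1)), p ω := by
  rw [ae_iff, ← Set.compl_ofPred, ← lintegral_indicator_one hp.compl,
    lintegral_pathLaw_succ π F t (measurable_one.indicator hp.compl)]
  refine (lintegral_congr_ae ?_).trans lintegral_zero
  filter_upwards [h] with ω hω
  refine Finset.sum_eq_zero fun k _ => ?_
  rcases eq_or_ne (π.act t (ω.take t) {k}) 0 with hk | hk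
  · rw [hk, mul_zero]
  · simp [hω k hk]

theorem ae_act_ne_zero (π : Policy K) (F : Env K) (T : ℕ) :
    ∀ᵐ ω ∂(π.pathLaw F T), ∀ t < T, π.act t (ω.take t) {ω.arm t} ≠ 0 := by
  induction T with
  | zero => simp
  | succ T ih =>
    refine ae_pathLaw_succ ?_ ?_
    · simp only [Set.ofPred_forall]
      exact .iInter fun t => .iInter fun _ => measurable_act π t (measurableSet_singleton 0).compl
    · filter_upwards [ih] with ω hω k hk x t ht
      rw [take_update _ _ (Nat.le_of_lt_succ ht)]
      rcases Nat.lt_succ_iff_lt_or_eq.1 ht with ht | rfl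
      · rw [arm_update_of_ne _ _ ht.ne]
        exact hω t ht
      · rwa [arm_update_self]

end PathLaw

/-! ### Measurability -/

theorem measurable_sum_mem {Ω ι M : Type*} [MeasurableSpace Ω] [AddCommMonoid M]
    [MeasurableSpace M] [MeasurableAdd₂ M] {B : Ω → Finset ι} {S : Finset ι}
    (hBS : ∀ ω, B ω ⊆ S) (hB : ∀ i, MeasurableSet {ω | i ∈ B ω}) {f : Ω → ι → M}
    (hf : ∀ i, Measurable fun ω => f ω i) : Measurable fun ω => ∑ i ∈ B ω, f ω i := by
  classical
  have h : ∀ ω, ∑ i ∈ B ω, f ω i = ∑ i ∈ S, if i ∈ B ω then f ω i else 0 := fun ω => by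
    rw [Finset.sum_ite_mem, Finset.inter_eq_right.2 (hBS ω)]
  simp only [h]
  exact Finset.measurable_fun_sum S fun i _ => (hf i).ite (hB i) measurable_const

theorem measurable_card_mem {Ω ι : Type*} [MeasurableSpace Ω] {B : Ω → Finset ι}
    {S : Finset ι} (hBS : ∀ ω, B ω ⊆ S) (hB : ∀ i, MeasurableSet {ω | i ∈ B ω}) :
    Measurable fun ω => (B ω).card := by
  simp only [Finset.card_eq_sum_ones]
  exact measurable_sum_mem hBS hB fun _ => measurable_const

theorem measurableSet_mem_picks (k : Fin K) (u v s : ℕ) :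
    MeasurableSet {ω : Path K | s ∈ picks ω.arm k u v} := by
  simp only [mem_picks]
  exact (MeasurableSet.const _).inter (measurable_arm s (measurableSet_singleton k))

theorem picks_subset_range {α : Type*} [DecidableEq α] (φ : ℕ → α) (k : α) (u v : ℕ) :
    picks φ k u v ⊆ Finset.range v := fun _ hs => Finset.mem_range.2 (mem_picks.1 hs).1.2

theorem block_subset_range {α : Type*} [DecidableEq α] (φ : ℕ → α) (k : α) (u v a b : ℕ) :
    block φ k u v a b ⊆ Finset.range v := fun _ hs => Finset.mem_range.2 (mem_block.1 hs).1.2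

@[fun_prop]
theorem measurable_pulls (k : Fin K) (u v : ℕ) : Measurable fun ω : Path K => pulls ω.arm k u v :=
  measurable_card_mem (fun ω => picks_subset_range ω.arm k u v) (measurableSet_mem_picks k u v)

theorem measurableSet_mem_block (k : Fin K) (u v a b s : ℕ) :
    MeasurableSet {ω : Path K | s ∈ block ω.arm k u v a b} := by
  simp only [mem_block]
  exact (MeasurableSet.const _).inter ((measurable_arm s (measurableSet_singleton k)).inter
    ((measurableSet_le measurable_const (measurable_pulls k u s)).inter
      (measurableSet_lt (measurable_pulls k u s) measurable_const)))

theorem measurable_sum_picks_noise (F : Env K) (k : Fin K) (u v : ℕ) :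
    Measurable fun ω : Path K => ∑ s ∈ picks ω.arm k u v, F.noise ω s :=
  measurable_sum_mem (fun ω => picks_subset_range ω.arm k u v) (measurableSet_mem_picks k u v)
    (measurable_noise F)

theorem measurable_sum_block_noise (F : Env K) (k : Fin K) (u v a b : ℕ) :
    Measurable fun ω : Path K => ∑ s ∈ block ω.arm k u v a b, F.noise ω s :=
  measurable_sum_mem (B := fun ω : Path K => block ω.arm k u v a b)
    (fun ω => block_subset_range ω.arm k u v a b) (measurableSet_mem_block k u v a b)
    (measurable_noise F)

@[fun_prop]
theorem measurable_bonus (η H : ℝ) : Measurable (bonus η H) := by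
  unfold bonus
  fun_prop

theorem measurable_shortfall (F : Env K) (η H : ℝ) (k : Fin K) (u t : ℕ) :
    Measurable fun ω : Path K => shortfall ω.arm (F.noise ω) η H k u t := by
  have hS := measurable_sum_picks_noise F k u t
  exact measurable_const.max (by fun_prop)

theorem measurable_chainEnergy (F : Env K) (k : Fin K) (u v : ℕ) (H : ℝ) :
    Measurable fun ω : Path K => chainEnergy ω.arm (F.noise ω) k u v H := by
  exact Finset.measurable_fun_sum _ fun j _ => Finset.measurable_fun_sum _ fun i _ =>
    ((measurable_sum_block_noise F k u v _ _).pow_const 8).const_mul _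

/-! ### The exponential supermartingale and moments of the noise -/

/-- A random finite set of rounds such that the observations before round `s` and the arm selected
in round `s` determine whether `s` belongs to it. -/
structure IsPredictable (B : Path K → Finset ℕ) : Prop where
  measurableSet : ∀ s, MeasurableSet {ω | s ∈ B ω}
  congr : ∀ s (ω ω' : Path K), (∀ r < s, ω r = ω' r) → ω.arm s = ω'.arm s →
    (s ∈ B ω ↔ s ∈ B ω')

theorem IsPredictable.measurableSet_nonempty {B : Path K → Finset ℕ} (hB : IsPredictable B) :
    MeasurableSet {ω | (B ω).Nonempty} := by
  simp only [Finset.Nonempty, Set.ofPred_exists]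
  exact .iUnion hB.measurableSet

theorem isPredictable_picks (k : Fin K) (u v : ℕ) :
    IsPredictable fun ω : Path K => picks ω.arm k u v where
  measurableSet := measurableSet_mem_picks k u v
  congr s ω ω' _ harm := by rw [mem_picks, mem_picks, harm]

theorem pulls_congr {ω ω' : Path K} {s : ℕ} (h : ∀ r < s, ω r = ω' r) (k : Fin K) (u : ℕ) :
    pulls ω.arm k u s = pulls ω'.arm k u s := by
  rw [pulls, pulls, picks, picks]
  congr 1
  refine Finset.filter_congr fun r hr => ?_
  rw [Path.arm, Path.arm, h r (Finset.mem_Ico.1 hr).2]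

theorem isPredictable_block (k : Fin K) (u v a b : ℕ) :
    IsPredictable fun ω : Path K => block ω.arm k u v a b where
  measurableSet := measurableSet_mem_block k u v a b
  congr s ω ω' h harm := by rw [mem_block, mem_block, harm, pulls_congr h]

/-- Up to the horizon `T` the rewards are sub-Gaussian around their means with variance
proxy `c`. -/
def Env.IsSubgaussian (F : Env K) (c : NNReal) (T : ℕ) : Prop :=
  ∀ t < T, ∀ k, HasSubgaussianMGF (fun x : ℝ => x - F.mean t k) c (F t k : Measure ℝ)

theorem lintegral_exp_sub_le_one {Ω : Type*} [MeasurableSpace Ω] {μ : Measure Ω} {X : Ω → ℝ}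
    {c : NNReal} (hX : HasSubgaussianMGF X c μ) (l : ℝ) :
    ∫⁻ ω, ENNReal.ofReal (Real.exp (l * X ω - c * l ^ 2 / 2)) ∂μ ≤ 1 := by
  simp only [Real.exp_sub]
  rw [← ofReal_integral_eq_lintegral_ofReal ((hX.integrable_exp_mul l).div_const _)
    (ae_of_all _ fun ω => by positivity), integral_div, ENNReal.ofReal_le_one,
    div_le_one (Real.exp_pos _)]
  exact hX.mgf_le l

variable [NeZero K] {π : Policy K} {F : Env K} {c : NNReal} {T : ℕ} {B : Path K → Finset ℕ}

theorem lintegral_mul_pathLaw_succ_le {f g : Path K → ENNReal} (hf : Measurable f)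
    (hg : Measurable g) (hfT : ∀ ω p, f (Function.update ω T p) = f ω)
    (hgT : ∀ ω k, ∫⁻ x, g (Function.update ω T (k, x)) ∂(F T k : Measure ℝ) ≤ 1) :
    ∫⁻ ω, f ω * g ω ∂(π.pathLaw F (T + 1)) ≤ ∫⁻ ω, f ω ∂(π.pathLaw F T) := by
  rw [lintegral_pathLaw_succ π F T (f := fun ω => f ω * g ω) (hf.mul hg)]
  refine lintegral_mono fun ω => ?_
  have hinner : ∀ k, ∫⁻ x, f (Function.update ω T (k, x)) * g (Function.update ω T (k, x))
      ∂(F T k : Measure ℝ) ≤ f ω := fun k => by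
    have hgk : Measurable fun x => g (Function.update ω T (k, x)) :=
      hg.comp ((measurable_update_prod T).comp
        (measurable_const.prodMk (measurable_const.prodMk measurable_id)))
    simp only [hfT]
    rw [lintegral_const_mul _ hgk]
    exact mul_le_of_le_one_right zero_le (hgT ω k)
  calc _ ≤ ∑ k, f ω * π.act T (ω.take T) {k} :=
        Finset.sum_le_sum fun k _ => mul_le_mul_left (hinner k) _
    _ = f ω := by rw [← Finset.mul_sum, sum_measure_singleton]; simp

theorem lintegral_exp_sum_range_noise_le_one (hF : F.IsSubgaussian c T) (hB : IsPredictable B)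
    (l : ℝ) :
    ∫⁻ ω, ENNReal.ofReal (Real.exp (∑ s ∈ Finset.range T,
      if s ∈ B ω then l * F.noise ω s - c * l ^ 2 / 2 else 0)) ∂(π.pathLaw F T) ≤ 1 := by
  set Z : ℕ → Path K → ℝ := fun s ω =>
    if s ∈ B ω then l * F.noise ω s - c * l ^ 2 / 2 else 0
  have hZ : ∀ s, Measurable (Z s) := fun s =>
    Measurable.ite (hB.measurableSet s) (by fun_prop) measurable_const
  have hpast : ∀ {s t}, s < t → ∀ ω p, Z s (Function.update ω t p) = Z s ω :=
    fun {s t} hst ω p => by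
      have hmem := hB.congr s (Function.update ω t p) ω
        (fun r hr => Function.update_of_ne (by omega) _ _) (arm_update_of_ne ω p hst.ne)
      simp only [Z, hmem, noise_update_of_ne F ω p hst.ne]
  induction T with
  | zero => simp
  | succ T ih =>
    simp only [Finset.sum_range_succ, Real.exp_add, ENNReal.ofReal_mul (Real.exp_pos _).le]
    refine (lintegral_mul_pathLaw_succ_le
      (Finset.measurable_fun_sum _ fun s _ => hZ s).exp.ennreal_ofReal (hZ T).exp.ennreal_ofReal
      (fun ω p => ?_) fun ω k => ?_).trans (ih fun t ht => hF t (by omega))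
    · rw [Finset.sum_congr rfl fun s hs => hpast (Finset.mem_range.1 hs) ω p]
    · have hmem : ∀ x, T ∈ B (Function.update ω T (k, x)) ↔ T ∈ B (Function.update ω T (k, 0)) :=
        fun x => hB.congr T _ _ (fun r hr => by simp [hr.ne]) (by simp [arm_update_self])
      by_cases h : T ∈ B (Function.update ω T (k, 0))
      · simpa [Z, hmem, h, Env.noise, Path.arm] using
          lintegral_exp_sub_le_one (hF T (by omega) k) l
      · simp [Z, hmem, h]

theorem lintegral_exp_sum_noise_le_one (hF : F.IsSubgaussian c T) (hB : IsPredictable B)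
    (hBT : ∀ ω, B ω ⊆ Finset.range T) (l : ℝ) :
    ∫⁻ ω, ENNReal.ofReal (Real.exp (l * ∑ s ∈ B ω, F.noise ω s - c * l ^ 2 / 2 * (B ω).card))
      ∂(π.pathLaw F T) ≤ 1 := by
  refine (lintegral_congr fun ω => ?_).trans_le (lintegral_exp_sum_range_noise_le_one hF hB l)
  rw [Finset.sum_ite_mem, Finset.inter_eq_right.2 (hBT ω), Finset.sum_sub_distrib,
    Finset.mul_sum, Finset.sum_const, nsmul_eq_mul, mul_comm (c * l ^ 2 / 2)]

theorem setLIntegral_exp_sum_noise_le (hF : F.IsSubgaussian c T) (hB : IsPredictable B)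
    (hBT : ∀ ω, B ω ⊆ Finset.range T) (l : ℝ) :
    ∫⁻ ω in {ω | (B ω).Nonempty}, ENNReal.ofReal
        (Real.exp (l * ∑ s ∈ B ω, F.noise ω s - c * l ^ 2 / 2 * (B ω).card)) ∂(π.pathLaw F T)
      ≤ π.pathLaw F T {ω | (B ω).Nonempty} := by
  have hA := hB.measurableSet_nonempty
  have hempty : ∫⁻ ω in {ω | (B ω).Nonempty}ᶜ, ENNReal.ofReal
      (Real.exp (l * ∑ s ∈ B ω, F.noise ω s - c * l ^ 2 / 2 * (B ω).card)) ∂(π.pathLaw F T)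
      = π.pathLaw F T {ω | (B ω).Nonempty}ᶜ := by
    refine (setLIntegral_congr_fun hA.compl fun ω hω => ?_).trans (setLIntegral_one _)
    simp [Finset.not_nonempty_iff_eq_empty.1 hω]
  have htotal := lintegral_exp_sum_noise_le_one (π := π) hF hB hBT l
  rw [← lintegral_add_compl _ hA, hempty, ← prob_add_prob_compl (μ := π.pathLaw F T) hA] at htotal
  exact (ENNReal.add_le_add_iff_right (measure_ne_top _ _)).1 htotal

theorem pow_two_mul_le_exp_sub_add_exp_sub {x n r : ℝ} {m : ℕ} (hr : 0 < r) (hnr : n ≤ r) :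
    x ^ (2 * m) ≤ (2 * m).factorial * Real.exp (c / 2) * r ^ m *
      (Real.exp ((√r)⁻¹ * x - c * (√r)⁻¹ ^ 2 / 2 * n)
        + Real.exp (-(√r)⁻¹ * x - c * (-(√r)⁻¹) ^ 2 / 2 * n)) := by
  have hdrift : 1 ≤ Real.exp (c / 2) * Real.exp (-(c * (√r)⁻¹ ^ 2 / 2 * n)) := by
    rw [← Real.exp_add, Real.one_le_exp_iff, inv_pow, Real.sq_sqrt hr.le,
      show c / 2 + -(c * r⁻¹ / 2 * n) = c / 2 * (1 - n / r) by ring]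
    exact mul_nonneg (by positivity) (sub_nonneg.2 ((div_le_one hr).2 hnr))
  calc x ^ (2 * m) = r ^ m * ((√r)⁻¹ * x) ^ (2 * m) := by
        rw [mul_pow, pow_mul (√r)⁻¹, inv_pow, Real.sq_sqrt hr.le, ← mul_assoc, ← mul_pow,
          mul_inv_cancel₀ hr.ne', one_pow, one_mul]
    _ ≤ r ^ m * ((2 * m).factorial * (Real.exp ((√r)⁻¹ * x) + Real.exp (-((√r)⁻¹ * x)))) := by
        gcongr
        exact pow_two_mul_le_exp_add_exp_neg _ m
    _ ≤ r ^ m * ((2 * m).factorial * (Real.exp ((√r)⁻¹ * x) + Real.exp (-((√r)⁻¹ * x))))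
          * (Real.exp (c / 2) * Real.exp (-(c * (√r)⁻¹ ^ 2 / 2 * n))) :=
        le_mul_of_one_le_right (by positivity) hdrift
    _ = _ := by
        rw [neg_sq, sub_eq_add_neg, sub_eq_add_neg, Real.exp_add, Real.exp_add, neg_mul]
        ring

theorem lintegral_sum_noise_pow_le (hF : F.IsSubgaussian c T) (hB : IsPredictable B)
    (hBT : ∀ ω, B ω ⊆ Finset.range T) {r m : ℕ} (hr : 0 < r) (hm : m ≠ 0)
    (hcard : ∀ ω, (B ω).card ≤ r) :
    ∫⁻ ω, ENNReal.ofReal ((∑ s ∈ B ω, F.noise ω s) ^ (2 * m)) ∂(π.pathLaw F T)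
      ≤ ENNReal.ofReal (2 * (2 * m).factorial * Real.exp (c / 2) * r ^ m)
        * π.pathLaw F T {ω | (B ω).Nonempty} := by
  have hsupp : Function.support (fun ω : Path K =>
      ENNReal.ofReal ((∑ s ∈ B ω, F.noise ω s) ^ (2 * m))) ⊆ {ω | (B ω).Nonempty} := by
    intro ω hω
    by_contra hne
    exact hω (by simp [Finset.not_nonempty_iff_eq_empty.1 hne, hm])
  have hexp : ∀ l : ℝ, Measurable fun ω : Path K => ENNReal.ofReal
      (Real.exp (l * ∑ s ∈ B ω, F.noise ω s - c * l ^ 2 / 2 * (B ω).card)) := fun l => by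
    have h1 := measurable_sum_mem hBT hB.measurableSet (measurable_noise F)
    have h2 := measurable_card_mem hBT hB.measurableSet
    fun_prop
  set C : ℝ := (2 * m).factorial * Real.exp (c / 2) * r ^ m
  have hC : 0 ≤ C := by positivity
  rw [← setLIntegral_eq_of_support_subset hsupp]
  calc _ ≤ ∫⁻ ω in {ω | (B ω).Nonempty}, ENNReal.ofReal C *
        (ENNReal.ofReal (Real.exp ((√r)⁻¹ * ∑ s ∈ B ω, F.noise ω s
            - c * (√r)⁻¹ ^ 2 / 2 * (B ω).card))
          + ENNReal.ofReal (Real.exp (-(√r)⁻¹ * ∑ s ∈ B ω, F.noise ω s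
            - c * (-(√r)⁻¹) ^ 2 / 2 * (B ω).card))) ∂(π.pathLaw F T) := by
        refine lintegral_mono fun ω => ?_
        rw [← ENNReal.ofReal_add (by positivity) (by positivity), ← ENNReal.ofReal_mul hC]
        exact ENNReal.ofReal_le_ofReal (pow_two_mul_le_exp_sub_add_exp_sub (by exact_mod_cast hr)
          (by exact_mod_cast hcard ω))
    _ ≤ ENNReal.ofReal C * (π.pathLaw F T {ω | (B ω).Nonempty}
          + π.pathLaw F T {ω | (B ω).Nonempty}) := by
        rw [lintegral_const_mul' _ _ ENNReal.ofReal_ne_top, lintegral_add_left (hexp _)]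
        gcongr <;> exact setLIntegral_exp_sum_noise_le hF hB hBT _
    _ = _ := by
        rw [← two_mul, ← mul_assoc, mul_comm _ 2, ← ENNReal.ofReal_ofNat, ← ENNReal.ofReal_mul
          zero_le_two]
        congr 2
        ring

/-! ### The expected excess -/

theorem card_filter_mul_lt_le (n L : ℕ) {r : ℕ} (hr : 0 < r) :
    {i ∈ Finset.range n | i * r < L}.card ≤ L / r + 1 := by
  refine (Finset.card_le_card fun i hi => ?_).trans (Finset.card_range _).le
  rw [Finset.mem_filter] at hi
  exact Finset.mem_range_succ_iff.2 ((Nat.le_div_iff_mul_le hr).2 hi.2.le)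

omit [NeZero K] in
theorem sum_measure_nonempty_block_le (μ : Measure (Path K)) (k : Fin K) (u v n : ℕ) {r : ℕ}
    (hr : 0 < r) :
    ∑ i ∈ Finset.range n, μ {ω | (block ω.arm k u v (i * r) ((i + 1) * r)).Nonempty}
      ≤ ∫⁻ ω, ENNReal.ofReal (1 + pulls ω.arm k u v / r) ∂μ := by
  have hmeas : ∀ i, MeasurableSet {ω : Path K | i * r < pulls ω.arm k u v} := fun i =>
    measurableSet_lt measurable_const (measurable_pulls k u v)
  calc _ ≤ ∑ i ∈ Finset.range n, μ {ω | i * r < pulls ω.arm k u v} := by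
        refine Finset.sum_le_sum fun i _ => measure_mono fun ω hω => ?_
        by_contra h
        exact Finset.not_nonempty_iff_eq_empty.2 (block_eq_empty (not_lt.1 h)) hω
    _ = ∫⁻ ω, ({i ∈ Finset.range n | i * r < pulls ω.arm k u v}.card : ENNReal) ∂μ := by
        simp only [← fun i => lintegral_indicator_one (μ := μ) (hmeas i)]
        rw [← lintegral_finsetSum _ fun i _ => measurable_one.indicator (hmeas i)]
        refine lintegral_congr fun ω => ?_
        simp [Set.indicator_apply]
    _ ≤ _ := by
        refine lintegral_mono fun ω => ?_
        rw [← ENNReal.ofReal_natCast]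
        refine ENNReal.ofReal_le_ofReal ?_
        calc (({i ∈ Finset.range n | i * r < pulls ω.arm k u v}.card : ℕ) : ℝ)
            ≤ ((pulls ω.arm k u v / r : ℕ) : ℝ) + 1 := by
              exact_mod_cast card_filter_mul_lt_le n _ hr
          _ ≤ 1 + pulls ω.arm k u v / r := by
              rw [add_comm]
              gcongr
              exact Nat.cast_div_le

/-- The constant of `lintegral_chainEnergy_le` for noise with variance proxy `c`. -/
def chainEnergyConst (c : ℝ) : ℝ := 8 * (Nat.factorial 8) * Real.exp (c / 2) * dyadicConst 1

theorem chainEnergyConst_pos (c : ℝ) : 0 < chainEnergyConst c :=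
  mul_pos (by positivity) (dyadicConst_pos one_pos)

theorem lintegral_sum_block_noise_pow_eight_le (hF : F.IsSubgaussian c T) (k : Fin K) (u : ℕ)
    {v : ℕ} (hv : v ≤ T) {r : ℕ} (hr : 0 < r) (i : ℕ) :
    ∫⁻ ω, ENNReal.ofReal ((∑ s ∈ block ω.arm k u v (i * r) ((i + 1) * r), F.noise ω s) ^ 8)
        ∂(π.pathLaw F T)
      ≤ ENNReal.ofReal (2 * (Nat.factorial 8) * Real.exp (c / 2) * r ^ 4)
        * π.pathLaw F T {ω | (block ω.arm k u v (i * r) ((i + 1) * r)).Nonempty} :=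
  lintegral_sum_noise_pow_le (m := 4) hF (isPredictable_block k u v _ _)
    (fun ω => (block_subset_range ω.arm k u v _ _).trans (Finset.range_subset_range.2 hv)) hr
    four_ne_zero fun ω => (card_block_le ω.arm k u v _ _).trans_eq (by rw [← Nat.sub_mul]; simp)

theorem lintegral_chainEnergy_scale_le (hF : F.IsSubgaussian c T) (k : Fin K) (u : ℕ) {v : ℕ}
    (hv : v ≤ T) {H : ℝ} (hH : 0 < H) (n j : ℕ) :
    ∑ i ∈ Finset.range n, ∫⁻ ω, ENNReal.ofReal (chainWeight (2 ^ j / H) / H ^ 4 *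
        (∑ s ∈ block ω.arm k u v (i * 2 ^ j) ((i + 1) * 2 ^ j), F.noise ω s) ^ 8) ∂(π.pathLaw F T)
      ≤ ENNReal.ofReal (2 * (Nat.factorial 8) * Real.exp (c / 2)
          * min (2 ^ j / H) (2 ^ j / H)⁻¹)
        * ∫⁻ ω, ENNReal.ofReal (1 + pulls ω.arm k u v / H) ∂(π.pathLaw F T) := by
  set μ := π.pathLaw F T
  set z : ℝ := 2 ^ j / H with hz
  set A : ℝ := 2 * (Nat.factorial 8) * Real.exp (c / 2)
  have hz0 : 0 < z := by positivity
  have hA : 0 ≤ A := by positivity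
  have hw := (chainWeight_pos hz0).le
  have hmoment : ∀ i, ∫⁻ ω, ENNReal.ofReal (chainWeight z / H ^ 4 *
        (∑ s ∈ block ω.arm k u v (i * 2 ^ j) ((i + 1) * 2 ^ j), F.noise ω s) ^ 8) ∂μ
      ≤ ENNReal.ofReal (A * (chainWeight z * z ^ 4))
        * μ {ω | (block ω.arm k u v (i * 2 ^ j) ((i + 1) * 2 ^ j)).Nonempty} := fun i => by
    simp only [ENNReal.ofReal_mul (div_nonneg hw (by positivity : 0 ≤ H ^ 4))]
    rw [lintegral_const_mul' _ _ ENNReal.ofReal_ne_top,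
      show A * (chainWeight z * z ^ 4) = chainWeight z / H ^ 4 * (A * (2 ^ j : ℕ) ^ 4) by
        rw [hz]; push_cast; field_simp,
      ENNReal.ofReal_mul (div_nonneg hw (by positivity)), mul_assoc]
    gcongr
    exact lintegral_sum_block_noise_pow_eight_le hF k u hv (by positivity) i
  calc _ ≤ ∑ i ∈ Finset.range n, _ := Finset.sum_le_sum fun i _ => hmoment i
    _ ≤ ENNReal.ofReal (A * (chainWeight z * z ^ 4))
          * ∫⁻ ω, ENNReal.ofReal (1 + pulls ω.arm k u v / (2 ^ j : ℕ)) ∂μ := by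
        rw [← Finset.mul_sum]
        gcongr
        exact sum_measure_nonempty_block_le μ k u v n (by positivity)
    _ ≤ _ := by
        rw [← lintegral_const_mul' _ _ ENNReal.ofReal_ne_top,
          ← lintegral_const_mul' _ _ ENNReal.ofReal_ne_top]
        refine lintegral_mono fun ω => ?_
        rw [← ENNReal.ofReal_mul (by positivity), ← ENNReal.ofReal_mul (by positivity)]
        refine ENNReal.ofReal_le_ofReal ?_
        rw [mul_assoc A, mul_assoc A]
        refine mul_le_mul_of_nonneg_left ?_ hA
        set N : ℝ := (pulls ω.arm k u v : ℝ)
        calc chainWeight z * z ^ 4 * (1 + N / (2 ^ j : ℕ))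
            = chainWeight z * z ^ 4 + chainWeight z * z ^ 3 * (N / H) := by
              rw [hz]; push_cast; field_simp
          _ ≤ min z z⁻¹ + min z z⁻¹ * (N / H) := by
              gcongr <;> exact chainWeight_mul_pow_le hz0 (by norm_num) (by norm_num)
          _ = min z z⁻¹ * (1 + N / H) := by ring

theorem lintegral_chainEnergy_le (hF : F.IsSubgaussian c T) (k : Fin K) (u : ℕ) {v : ℕ}
    (hv : v ≤ T) {H : ℝ} (hH : 0 < H) :
    ∫⁻ ω, ENNReal.ofReal (chainEnergy ω.arm (F.noise ω) k u v H) ∂(π.pathLaw F T)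
      ≤ ENNReal.ofReal (chainEnergyConst c)
        * ∫⁻ ω, ENNReal.ofReal (1 + pulls ω.arm k u v / H) ∂(π.pathLaw F T) := by
  have hmeas : ∀ j i, Measurable fun ω : Path K => chainWeight (2 ^ j / H) / H ^ 4 *
      (∑ s ∈ block ω.arm k u v (i * 2 ^ j) ((i + 1) * 2 ^ j), F.noise ω s) ^ 8 := fun j i =>
    ((measurable_sum_block_noise F k u v _ _).pow_const 8).const_mul _
  have hsum := sum_min_inv_dyadic_rpow_le hH one_pos v
  simp only [Real.rpow_one] at hsum
  simp only [chainEnergy]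
  rw [lintegral_ofReal_sum _ (fun j _ => Finset.measurable_fun_sum _ fun i _ => hmeas j i)
    fun j _ ω => Finset.sum_nonneg fun i _ => chainEnergy_summand_nonneg hH _ j]
  simp only [fun j => lintegral_ofReal_sum (μ := π.pathLaw F T) (Finset.range v)
    (fun i _ => hmeas j i) fun _ _ _ => chainEnergy_summand_nonneg hH _ j]
  refine (Finset.sum_le_sum fun j _ => lintegral_chainEnergy_scale_le hF k u hv hH v j).trans ?_
  rw [← Finset.sum_mul, ← ENNReal.ofReal_sum_of_nonneg fun j _ => by positivity, ← Finset.mul_sum]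
  gcongr
  calc _ ≤ 2 * (Nat.factorial 8) * Real.exp (c / 2) * (4 * dyadicConst 1) := by gcongr
    _ = chainEnergyConst c := by rw [chainEnergyConst]; ring

theorem lintegral_chainEnergy_add_le (hF : F.IsSubgaussian c T) (k : Fin K) (u : ℕ) {v : ℕ}
    (hv : v ≤ T) {H : ℝ} (hH : 0 < H) :
    ∫⁻ ω, ENNReal.ofReal (chainEnergy ω.arm (F.noise ω) k u v H + (1 + pulls ω.arm k u v / H))
        ∂(π.pathLaw F T)
      ≤ ENNReal.ofReal (chainEnergyConst c + 1)
        * ∫⁻ ω, ENNReal.ofReal (1 + pulls ω.arm k u v / H) ∂(π.pathLaw F T) := by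
  have hadd : ∀ ω : Path K, ENNReal.ofReal (chainEnergy ω.arm (F.noise ω) k u v H
      + (1 + pulls ω.arm k u v / H)) = ENNReal.ofReal (chainEnergy ω.arm (F.noise ω) k u v H)
        + ENNReal.ofReal (1 + pulls ω.arm k u v / H) := fun ω =>
    ENNReal.ofReal_add (chainEnergy_nonneg hH) (by positivity)
  simp only [hadd]
  rw [lintegral_add_left (measurable_chainEnergy F k u v H).ennreal_ofReal,
    ENNReal.ofReal_add (chainEnergyConst_pos c).le zero_le_one, ENNReal.ofReal_one, add_mul,
    one_mul]
  gcongr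
  exact lintegral_chainEnergy_le hF k u hv hH

theorem sum_lintegral_chainEnergy_add_le (hF : F.IsSubgaussian c T) (u : ℕ) {v : ℕ} (hv : v ≤ T)
    {H : ℝ} (hH : 0 < H) :
    ∑ k, ∫⁻ ω, ENNReal.ofReal (chainEnergy ω.arm (F.noise ω) k u v H + (1 + pulls ω.arm k u v / H))
        ∂(π.pathLaw F T)
      ≤ ENNReal.ofReal ((chainEnergyConst c + 1) * (K + (v - u : ℕ) / H)) := by
  have hsum : ∀ ω : Path K, ∑ k, (1 + pulls ω.arm k u v / H) = K + (v - u : ℕ) / H := fun ω => by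
    rw [Finset.sum_add_distrib, ← Finset.sum_div, ← Nat.cast_sum, sum_pulls]
    simp
  refine (Finset.sum_le_sum fun k _ => lintegral_chainEnergy_add_le hF k u hv hH).trans_eq ?_
  rw [← Finset.mul_sum,
    ← lintegral_ofReal_sum _ (fun k _ => by fun_prop) fun k _ ω => by positivity,
    ENNReal.ofReal_mul (add_pos (chainEnergyConst_pos c) one_pos).le]
  simp [hsum]

/-- The constant of `lintegral_sum_excess_le` for noise with variance proxy `c`. -/
def excessConst (η c : ℝ) : ℝ := 24 * (2 * chainConst + √(2 * η)) * (chainEnergyConst c + 1)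

theorem excessConst_nonneg (η c : ℝ) : 0 ≤ excessConst η c := by
  have hchain := chainConst_pos
  have henergy := chainEnergyConst_pos c
  unfold excessConst
  positivity

theorem lintegral_sum_excess_le (hF : F.IsSubgaussian c T) {η : ℝ} (hη : 0 ≤ η) {τ m : ℕ}
    (hτ : 0 < τ) (hm : T ≤ m * τ) :
    ∫⁻ ω, ENNReal.ofReal (∑ t ∈ Finset.range T,
        excess ω.arm (F.noise ω) η (τ / K) (ω.arm t) (t - τ) t) ∂(π.pathLaw F T)
      ≤ ENNReal.ofReal (excessConst η c * m * (K * √(τ / K))) := by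
  set μ := π.pathLaw F T
  set H : ℝ := τ / K with hHdef
  have hK : (0 : ℝ) < K := by exact_mod_cast NeZero.pos K
  have hH : 0 < H := by positivity
  set D : ℝ := 8 * (2 * chainConst + √(2 * η)) * √H
  have hD : 0 ≤ D := by have := chainConst_pos; positivity
  have hE := chainEnergyConst_pos c
  set Y : ℕ → Fin K → Path K → ℝ := fun i k ω =>
    chainEnergy ω.arm (F.noise ω) k (epochStart τ T i - τ) (epochStart τ T (i + 1)) H
      + (1 + pulls ω.arm k (epochStart τ T i - τ) (epochStart τ T (i + 1)) / H)
  have hY : ∀ i k, Measurable (Y i k) := fun i k =>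
    (measurable_chainEnergy F k _ _ H).add (by fun_prop)
  have hY0 : ∀ i k ω, 0 ≤ D * Y i k ω := fun i k ω =>
    mul_nonneg hD (add_nonneg (chainEnergy_nonneg hH) (by positivity))
  have hepoch : ∀ i, ∑ k, ∫⁻ ω, ENNReal.ofReal (D * Y i k ω) ∂μ
      ≤ ENNReal.ofReal (D * ((chainEnergyConst c + 1) * (3 * K))) := fun i => by
    have hlen : epochStart τ T (i + 1) - (epochStart τ T i - τ) ≤ 2 * τ := by
      have := epochStart_succ_le τ T i
      omega
    simp only [ENNReal.ofReal_mul hD, lintegral_const_mul' _ _ ENNReal.ofReal_ne_top]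
    rw [← Finset.mul_sum]
    gcongr
    refine (sum_lintegral_chainEnergy_add_le hF _ (min_le_right _ _) hH).trans ?_
    gcongr
    calc (K : ℝ) + (epochStart τ T (i + 1) - (epochStart τ T i - τ) : ℕ) / H
        ≤ K + (2 * τ : ℕ) / H := by gcongr
      _ = 3 * K := by rw [hHdef]; push_cast; field_simp; ring
  calc _ ≤ ∫⁻ ω, ENNReal.ofReal (∑ i ∈ Finset.range m, ∑ k, D * Y i k ω) ∂μ :=
        lintegral_mono fun ω => ENNReal.ofReal_le_ofReal (sum_range_excess_le hη hH hm)
    _ = ∑ i ∈ Finset.range m, ∑ k, ∫⁻ ω, ENNReal.ofReal (D * Y i k ω) ∂μ := by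
        rw [lintegral_ofReal_sum _ (fun i _ => Finset.measurable_fun_sum _ fun k _ =>
          (hY i k).const_mul D) fun i _ ω => Finset.sum_nonneg fun k _ => hY0 i k ω]
        exact Finset.sum_congr rfl fun i _ =>
          lintegral_ofReal_sum _ (fun k _ => (hY i k).const_mul D) fun k _ => hY0 i k
    _ ≤ ∑ i ∈ Finset.range m, ENNReal.ofReal (D * ((chainEnergyConst c + 1) * (3 * K))) :=
        Finset.sum_le_sum fun i _ => hepoch i
    _ = _ := by
        rw [Finset.sum_const, Finset.card_range, ← ENNReal.ofReal_nsmul, nsmul_eq_mul, excessConst]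
        congr 1
        ring

/-! ### The expected shortfall -/

theorem bonus_antitone {η H m n : ℝ} (hη : 0 ≤ η) (hH : 0 < H) (hm : 0 < m) (hmn : m ≤ n) :
    bonus η H n ≤ bonus η H m := by
  have hn : 0 < n := hm.trans_le hmn
  unfold bonus
  gcongr

theorem mul_bonus_sq {η H r : ℝ} (hη : 0 ≤ η) (hr : 0 < r) :
    r * bonus η H r ^ 2 = η * max (Real.log (H / r)) 0 := by
  rw [bonus, Real.sq_sqrt (by positivity)]
  field_simp

theorem exp_neg_mul_max_log_le {θ q H r : ℝ} (hq : 0 ≤ q) (hqθ : q ≤ θ) (hH : 0 < H)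
    (hr : 0 < r) : Real.exp (-(θ * max (Real.log (H / r)) 0)) ≤ (r / H) ^ q := by
  rw [Real.rpow_def_of_pos (by positivity), ← inv_div, Real.log_inv]
  refine Real.exp_le_exp.2 ?_
  calc -(θ * max (-Real.log (r / H)) 0) ≤ -(q * max (-Real.log (r / H)) 0) := by gcongr
    _ ≤ -(q * -Real.log (r / H)) := by gcongr; exact le_max_left _ _
    _ = Real.log (r / H) * q := by ring

theorem inv_sqrt_mul_exp_neg_le {θ δ H r : ℝ} (hδ : 0 ≤ δ) (hδ2 : δ ≤ 1 / 2)
    (hδθ : δ + 1 / 2 ≤ θ) (hH : 0 < H) (hr : 0 < r) :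
    (√r)⁻¹ * Real.exp (-(θ * max (Real.log (H / (2 * r))) 0))
      ≤ 2 / √H * min ((r / H) ^ δ) ((r / H) ^ δ)⁻¹ := by
  have hz : 0 < r / H := by positivity
  have hsqrt : √r = √H * (r / H) ^ (1 / 2 : ℝ) := by
    rw [← Real.sqrt_eq_rpow, Real.sqrt_div hr.le, mul_div_cancel₀ _ (Real.sqrt_pos.2 hH).ne']
  have hpow : ∀ p : ℝ, -(1 / 2) ≤ p → p ≤ δ →
      (√r)⁻¹ * Real.exp (-(θ * max (Real.log (H / (2 * r))) 0)) ≤ 2 / √H * (r / H) ^ p := by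
    intro p hp hpδ
    calc (√r)⁻¹ * Real.exp (-(θ * max (Real.log (H / (2 * r))) 0))
        ≤ (√r)⁻¹ * (2 * r / H) ^ (p + 1 / 2) := by
          gcongr
          exact exp_neg_mul_max_log_le (by linarith) (by linarith) hH (by positivity)
      _ = (√r)⁻¹ * (2 ^ (p + 1 / 2) * (r / H) ^ (p + 1 / 2)) := by
          rw [mul_div_assoc, Real.mul_rpow zero_le_two hz.le]
      _ ≤ (√r)⁻¹ * (2 ^ (1 : ℝ) * (r / H) ^ (p + 1 / 2)) := by
          gcongr
          · exact one_le_two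
          · linarith
      _ = 2 / √H * (r / H) ^ p := by
          rw [hsqrt, Real.rpow_one, Real.rpow_add hz]
          field_simp
  rw [mul_min_of_nonneg _ _ (by positivity), ← Real.rpow_neg hz.le]
  exact le_min (hpow δ (by linarith) le_rfl) (hpow (-δ) (by linarith) (by linarith))

/-- The exponent of the Chernoff bound for the shortfall of an arm with between `r` and `2 * r`
samples whose noise has variance proxy `c`. The summand `1 / √r` keeps the tilt away from `0` when
the bonus vanishes. -/
def shortfallTilt (η H c r : ℝ) : ℝ := bonus η H (2 * r) / c + (√r)⁻¹

/-- The bound for the expected shortfall of an arm with between `r` and `2 * r` samples which the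
Chernoff bound with exponent `shortfallTilt η H c r` gives. -/
def shortfallWeight (η H c r : ℝ) : ℝ :=
  Real.exp c * ((√r)⁻¹ * Real.exp (-(η / (4 * c) * max (Real.log (H / (2 * r))) 0)))

theorem shortfallWeight_nonneg (η H c r : ℝ) : 0 ≤ shortfallWeight η H c r := by
  unfold shortfallWeight
  positivity

theorem shortfallTilt_mul_le {η H c r S n : ℝ} (hη : 0 ≤ η) (hc : 0 < c) (hr : 0 < r)
    (hn : r ≤ n) (hn2 : n ≤ 2 * r) :
    shortfallTilt η H c r * (-S - n * bonus η H (2 * r)) ≤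
      c + -(η / (4 * c) * max (Real.log (H / (2 * r))) 0) +
        (-shortfallTilt η H c r * S - c * (-shortfallTilt η H c r) ^ 2 / 2 * n) := by
  set β := bonus η H (2 * r)
  have hsq : (√r)⁻¹ ^ 2 = r⁻¹ := by rw [inv_pow, Real.sq_sqrt hr.le]
  have hsplit : shortfallTilt η H c r * (-S - n * β) = n * (c / (2 * r)) - n * (β ^ 2 / (2 * c))
      + (-shortfallTilt η H c r * S - c * (-shortfallTilt η H c r) ^ 2 / 2 * n) := by
    have htilt : c * shortfallTilt η H c r = β + c * (√r)⁻¹ := by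
      rw [shortfallTilt, mul_add, mul_div_cancel₀ _ hc.ne']
    have hsquare : (c * shortfallTilt η H c r - β) ^ 2 = c ^ 2 * r⁻¹ := by
      rw [htilt, add_sub_cancel_left, mul_pow, hsq]
    field_simp at hsquare ⊢
    linear_combination n * hsquare
  have hconst : n * (c / (2 * r)) ≤ c := by
    calc n * (c / (2 * r)) ≤ 2 * r * (c / (2 * r)) := by gcongr
      _ = c := by field_simp
  have hbonus : η / (4 * c) * max (Real.log (H / (2 * r))) 0 ≤ n * (β ^ 2 / (2 * c)) := by
    calc η / (4 * c) * max (Real.log (H / (2 * r))) 0 = 2 * r * β ^ 2 / (4 * c) := by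
          rw [mul_bonus_sq hη (by positivity)]
          ring
      _ = r * (β ^ 2 / (2 * c)) := by ring
      _ ≤ n * (β ^ 2 / (2 * c)) := by gcongr
  linarith

theorem max_neg_average_add_bonus_le {η H c r S n : ℝ} (hη : 0 ≤ η) (hH : 0 < H) (hc : 0 < c)
    (hr : 0 < r) (hn : r ≤ n) (hn2 : n ≤ 2 * r) :
    max 0 (-(S / n + bonus η H n)) ≤ shortfallWeight η H c r *
      Real.exp (-shortfallTilt η H c r * S - c * (-shortfallTilt η H c r) ^ 2 / 2 * n) := by
  refine max_le (mul_nonneg (shortfallWeight_nonneg η H c r) (Real.exp_nonneg _)) ?_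
  have hn0 : 0 < n := hr.trans_le hn
  have hβ : 0 ≤ bonus η H (2 * r) := Real.sqrt_nonneg _
  have hmono : bonus η H (2 * r) ≤ bonus η H n := bonus_antitone hη hH hn0 hn2
  have hsqrt : 0 < √r := Real.sqrt_pos.2 hr
  have hexp := shortfallTilt_mul_le (H := H) (S := S) hη hc hr hn hn2
  set β := bonus η H (2 * r)
  set l := shortfallTilt η H c r
  have hl0 : 0 < l := add_pos_of_nonneg_of_pos (div_nonneg hβ hc.le) (inv_pos.2 hsqrt)
  have hsqrtle : √r ≤ l * n := by
    calc √r = (√r)⁻¹ * r := by rw [inv_mul_eq_div, Real.div_sqrt]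
      _ ≤ l * n := by
        gcongr
        exact le_add_of_nonneg_left (div_nonneg hβ hc.le)
  calc -(S / n + bonus η H n) ≤ -(S / n + β) := by gcongr
    _ = l * (-S - n * β) / (l * n) := by field_simp; ring
    _ ≤ Real.exp (l * (-S - n * β)) / (l * n) := by
        gcongr
        linarith [Real.add_one_le_exp (l * (-S - n * β))]
    _ ≤ Real.exp (l * (-S - n * β)) / √r := by gcongr
    _ ≤ Real.exp (c + -(η / (4 * c) * max (Real.log (H / (2 * r))) 0)
          + (-l * S - c * (-l) ^ 2 / 2 * n)) / √r := by gcongr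
    _ = _ := by rw [shortfallWeight, Real.exp_add, Real.exp_add]; ring

theorem sum_shortfallWeight_le {η H c δ : ℝ} (hH : 0 < H) (hδ : 0 < δ) (hδ2 : δ ≤ 1 / 2)
    (hδη : δ + 1 / 2 ≤ η / (4 * c)) (n : ℕ) :
    ∑ i ∈ Finset.range n, shortfallWeight η H c (2 ^ i)
      ≤ 8 * Real.exp c * dyadicConst δ / √H := by
  calc ∑ i ∈ Finset.range n, shortfallWeight η H c (2 ^ i)
      ≤ ∑ i ∈ Finset.range n, Real.exp c *
          (2 / √H * min (((2 : ℝ) ^ i / H) ^ δ) (((2 : ℝ) ^ i / H) ^ δ)⁻¹) := by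
        refine Finset.sum_le_sum fun i _ => mul_le_mul_of_nonneg_left ?_ (Real.exp_nonneg c)
        exact inv_sqrt_mul_exp_neg_le hδ.le hδ2 hδη hH (by positivity)
    _ ≤ Real.exp c * (2 / √H * (4 * dyadicConst δ)) := by
        rw [← Finset.mul_sum, ← Finset.mul_sum]
        gcongr
        exact sum_min_inv_dyadic_rpow_le hH hδ n
    _ = 8 * Real.exp c * dyadicConst δ / √H := by ring

theorem shortfall_le_sum {α : Type*} [DecidableEq α] {φ : ℕ → α} {x : ℕ → ℝ} {k : α} {u t : ℕ}
    {η H c : ℝ} (hη : 0 ≤ η) (hH : 0 < H) (hc : 0 < c) :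
    shortfall φ x η H k u t ≤ ∑ i ∈ Finset.range (t + 1), shortfallWeight η H c (2 ^ i) *
      Real.exp (-shortfallTilt η H c (2 ^ i) * ∑ s ∈ picks φ k u t, x s
        - c * (-shortfallTilt η H c (2 ^ i)) ^ 2 / 2 * pulls φ k u t) := by
  have hnonneg : ∀ i, 0 ≤ shortfallWeight η H c (2 ^ i) *
      Real.exp (-shortfallTilt η H c (2 ^ i) * ∑ s ∈ picks φ k u t, x s
        - c * (-shortfallTilt η H c (2 ^ i)) ^ 2 / 2 * pulls φ k u t) := fun i =>
    mul_nonneg (shortfallWeight_nonneg _ _ _ _) (Real.exp_nonneg _)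
  rcases eq_or_ne (pulls φ k u t) 0 with h0 | h0
  · refine le_trans (le_of_eq ?_) (Finset.sum_nonneg fun i _ => hnonneg i)
    simp [shortfall, h0, bonus]
  have hlog : Nat.log 2 (pulls φ k u t) < t + 1 :=
    ((Nat.log_lt_self 2 h0).trans_le ((pulls_le φ k u t).trans (Nat.sub_le t u))).trans
      t.lt_succ_self
  refine le_trans ?_ (Finset.single_le_sum (fun i _ => hnonneg i) (Finset.mem_range.2 hlog))
  refine max_neg_average_add_bonus_le hη hH hc (by positivity) ?_ ?_
  · exact_mod_cast Nat.pow_log_le_self 2 h0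
  · have hlt := Nat.lt_pow_succ_log_self one_lt_two (pulls φ k u t)
    rw [pow_succ'] at hlt
    exact_mod_cast hlt.le

theorem lintegral_shortfall_le (hF : F.IsSubgaussian c T) (hc : 0 < c) {η H δ : ℝ} (hH : 0 < H)
    (hδ : 0 < δ) (hδ2 : δ ≤ 1 / 2) (hδη : δ + 1 / 2 ≤ η / (4 * c)) (k : Fin K) {u t : ℕ}
    (ht : t ≤ T) :
    ∫⁻ ω, ENNReal.ofReal (shortfall ω.arm (F.noise ω) η H k u t) ∂(π.pathLaw F T)
      ≤ ENNReal.ofReal (8 * Real.exp c * dyadicConst δ / √H) := by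
  have hc' : (0 : ℝ) < c := hc
  have hη : 0 ≤ η := by
    have : 0 < η / (4 * c) := by linarith
    exact ((div_pos_iff_of_pos_right (by positivity)).1 this).le
  have hexp : ∀ l : ℝ, ∫⁻ ω, ENNReal.ofReal (Real.exp (l * ∑ s ∈ picks ω.arm k u t, F.noise ω s
      - c * l ^ 2 / 2 * pulls ω.arm k u t)) ∂(π.pathLaw F T) ≤ 1 := fun l =>
    lintegral_exp_sum_noise_le_one hF (isPredictable_picks k u t)
      (fun ω => (picks_subset_range ω.arm k u t).trans (Finset.range_mono ht)) l
  calc _ ≤ ∫⁻ ω, ENNReal.ofReal (∑ i ∈ Finset.range (t + 1), shortfallWeight η H c (2 ^ i) *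
          Real.exp (-shortfallTilt η H c (2 ^ i) * ∑ s ∈ picks ω.arm k u t, F.noise ω s
            - c * (-shortfallTilt η H c (2 ^ i)) ^ 2 / 2 * pulls ω.arm k u t))
          ∂(π.pathLaw F T) :=
        lintegral_mono fun ω => ENNReal.ofReal_le_ofReal (shortfall_le_sum hη hH hc')
    _ ≤ ∑ i ∈ Finset.range (t + 1), ENNReal.ofReal (shortfallWeight η H c (2 ^ i)) * 1 := by
        rw [lintegral_ofReal_sum _
          (fun i _ => by have := measurable_sum_picks_noise F k u t; fun_prop)
          fun i _ ω => mul_nonneg (shortfallWeight_nonneg _ _ _ _) (Real.exp_nonneg _)]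
        refine Finset.sum_le_sum fun i _ => ?_
        simp only [ENNReal.ofReal_mul (shortfallWeight_nonneg _ _ _ _)]
        rw [lintegral_const_mul' _ _ ENNReal.ofReal_ne_top]
        gcongr
        exact hexp _
    _ = ENNReal.ofReal (∑ i ∈ Finset.range (t + 1), shortfallWeight η H c (2 ^ i)) := by
        simp only [mul_one]
        rw [ENNReal.ofReal_sum_of_nonneg fun i _ => shortfallWeight_nonneg _ _ _ _]
    _ ≤ _ := ENNReal.ofReal_le_ofReal (sum_shortfallWeight_le hH hδ hδ2 hδη (t + 1))

/-! ### The regret of a single round -/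

section Round

variable (F) (ω : Path K) (k : Fin K) (η : ℝ) (τ t : ℕ)

omit [NeZero K] in
theorem map_windowPicks_take :
    (windowPicks τ (ω.take t) k).map Fin.valEmbedding = picks ω.arm k (t - τ) t := by
  unfold windowPicks
  ext s
  simp only [Finset.mem_map, Finset.mem_filter_univ, mem_picks, Fin.valEmbedding_apply]
  constructor
  · rintro ⟨r, ⟨hr, hk⟩, rfl⟩
    exact ⟨⟨by omega, r.2⟩, hk⟩
  · rintro ⟨⟨hs, hst⟩, hk⟩
    exact ⟨⟨s, hst⟩, ⟨Nat.sub_le_iff_le_add.1 hs, hk⟩, rfl⟩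

omit [NeZero K] in
theorem swIndex_take :
    swIndex η τ (ω.take t) k = if pulls ω.arm k (t - τ) t = 0 then ⊤ else
      (((∑ s ∈ picks ω.arm k (t - τ) t, (ω s).2) / pulls ω.arm k (t - τ) t
        + bonus η (τ / K) (pulls ω.arm k (t - τ) t) : ℝ) : EReal) := by
  rw [swIndex, pulls, ← map_windowPicks_take, Finset.card_map, Finset.sum_map, bonus, div_div]
  rfl

/-- The variation of the mean rewards within the window of round `t`. -/
def Env.drift : ℝ := ∑ s ∈ Finset.Ico (t - τ) t, ⨆ k, |F.mean (s + 1) k - F.mean s k|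

omit [NeZero K] in
theorem drift_nonneg : 0 ≤ F.drift τ t :=
  Finset.sum_nonneg fun _ _ => Real.iSup_nonneg fun _ => abs_nonneg _

omit [NeZero K] in
theorem variation_nonneg (T : ℕ) : 0 ≤ F.variation T :=
  Finset.sum_nonneg fun _ _ => Real.iSup_nonneg fun _ => abs_nonneg _

variable {τ t} in
omit [NeZero K] in
theorem abs_mean_sub_mean_le_drift {s : ℕ} (hs : t - τ ≤ s) (hst : s ≤ t) :
    |F.mean s k - F.mean t k| ≤ F.drift τ t := by
  calc |F.mean s k - F.mean t k| = |∑ r ∈ Finset.Ico s t, (F.mean (r + 1) k - F.mean r k)| := by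
        rw [Finset.sum_Ico_sub (fun r => F.mean r k) hst, abs_sub_comm]
    _ ≤ ∑ r ∈ Finset.Ico s t, |F.mean (r + 1) k - F.mean r k| := Finset.abs_sum_le_sum_abs _ _
    _ ≤ ∑ r ∈ Finset.Ico s t, ⨆ k, |F.mean (r + 1) k - F.mean r k| :=
        Finset.sum_le_sum fun r _ =>
          le_ciSup (f := fun k => |F.mean (r + 1) k - F.mean r k|) (Set.finite_range _).bddAbove k
    _ ≤ F.drift τ t :=
        Finset.sum_le_sum_of_subset_of_nonneg (Finset.Ico_subset_Ico_left hs)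
          fun _ _ _ => Real.iSup_nonneg fun _ => abs_nonneg _

omit [NeZero K] in
theorem sum_drift_le (T : ℕ) : ∑ t ∈ Finset.range T, F.drift τ t ≤ τ * F.variation T := by
  simp only [Env.drift, Env.variation, Finset.mul_sum]
  rw [Finset.sum_comm' (t' := Finset.range (T - 1))
    (s' := fun s => Finset.Ico (s + 1) (min (s + τ + 1) T)) fun t s => by
      simp only [Finset.mem_range, Finset.mem_Ico]
      omega]
  refine Finset.sum_le_sum fun s _ => ?_
  rw [Finset.sum_const, nsmul_eq_mul, Nat.card_Ico]
  gcongr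
  · exact Real.iSup_nonneg fun _ => abs_nonneg _
  · omega

variable {k τ t} in
omit [NeZero K] in
theorem abs_average_sub_average_noise_sub_mean_le (hn : pulls ω.arm k (t - τ) t ≠ 0) :
    |(∑ s ∈ picks ω.arm k (t - τ) t, (ω s).2) / pulls ω.arm k (t - τ) t
      - (∑ s ∈ picks ω.arm k (t - τ) t, F.noise ω s) / pulls ω.arm k (t - τ) t - F.mean t k|
      ≤ F.drift τ t := by
  have hn0 : (0 : ℝ) < (picks ω.arm k (t - τ) t).card := Nat.cast_pos.2 (Nat.pos_of_ne_zero hn)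
  have hdiff : ∑ s ∈ picks ω.arm k (t - τ) t, ((ω s).2 - F.noise ω s - F.mean t k)
      = ∑ s ∈ picks ω.arm k (t - τ) t, (F.mean s k - F.mean t k) :=
    Finset.sum_congr rfl fun s hs => by rw [Env.noise, sub_sub_cancel, (mem_picks.1 hs).2]
  rw [pulls, ← sub_div, div_sub' hn0.ne', ← Finset.sum_sub_distrib, ← nsmul_eq_mul,
    ← Finset.sum_const, ← Finset.sum_sub_distrib, hdiff, abs_div, Nat.abs_cast, div_le_iff₀ hn0,
    mul_comm, ← nsmul_eq_mul]
  refine (Finset.abs_sum_le_sum_abs _ _).trans (Finset.sum_le_card_nsmul _ _ _ fun s hs => ?_)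
  obtain ⟨⟨hs, hst⟩, -⟩ := mem_picks.1 hs
  exact abs_mean_sub_mean_le_drift F k hs hst.le

theorem exists_mean_eq_bestMean : ∃ k, F.mean t k = F.bestMean t := exists_eq_ciSup_of_finite

/-- An arm of maximal mean reward in round `t`. -/
def Env.bestArm : Fin K := (exists_mean_eq_bestMean F t).choose

theorem mean_bestArm : F.mean t (F.bestArm t) = F.bestMean t :=
  (exists_mean_eq_bestMean F t).choose_spec

omit [NeZero K] in
theorem mean_le_bestMean : F.mean t k ≤ F.bestMean t :=
  le_ciSup (f := fun k => F.mean t k) (Set.finite_range _).bddAbove k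

variable {F ω η τ t} in
theorem bestMean_sub_mean_arm_le {b : ℝ} (hb : F.bestMean t - F.mean t (ω.arm t) ≤ b)
    (hω : ∀ j, swIndex η τ (ω.take t) j ≤ swIndex η τ (ω.take t) (ω.arm t)) :
    F.bestMean t - F.mean t (ω.arm t) ≤
      (if pulls ω.arm (ω.arm t) (t - τ) t = 0 then b else 0) + 2 * F.drift τ t
        + shortfall ω.arm (F.noise ω) η (τ / K) (F.bestArm t) (t - τ) t
        + excess ω.arm (F.noise ω) η (τ / K) (ω.arm t) (t - τ) t := by
  have hdrift := drift_nonneg F τ t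
  have hshort : 0 ≤ shortfall ω.arm (F.noise ω) η (τ / K) (F.bestArm t) (t - τ) t :=
    shortfall_nonneg
  have hexcess : 0 ≤ excess ω.arm (F.noise ω) η (τ / K) (ω.arm t) (t - τ) t := excess_nonneg
  by_cases hn : pulls ω.arm (ω.arm t) (t - τ) t = 0
  · rw [if_pos hn]
    linarith
  have hindex := hω (F.bestArm t)
  rw [swIndex_take, swIndex_take, if_neg hn] at hindex
  have hbest : pulls ω.arm (F.bestArm t) (t - τ) t ≠ 0 := fun h => by
    rw [if_pos h, top_le_iff] at hindex
    exact EReal.coe_ne_top _ hindex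
  rw [if_neg hbest, EReal.coe_le_coe_iff] at hindex
  have hselected := abs_le.1 (abs_average_sub_average_noise_sub_mean_le F ω hn)
  have hoptimal := abs_le.1 (abs_average_sub_average_noise_sub_mean_le F ω hbest)
  rw [mean_bestArm] at hoptimal
  have hshortfall : -((∑ s ∈ picks ω.arm (F.bestArm t) (t - τ) t, F.noise ω s)
      / pulls ω.arm (F.bestArm t) (t - τ) t
      + bonus η (τ / K) (pulls ω.arm (F.bestArm t) (t - τ) t))
      ≤ shortfall ω.arm (F.noise ω) η (τ / K) (F.bestArm t) (t - τ) t := le_max_right _ _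
  have habs : (∑ s ∈ picks ω.arm (ω.arm t) (t - τ) t, F.noise ω s)
      / pulls ω.arm (ω.arm t) (t - τ) t + bonus η (τ / K) (pulls ω.arm (ω.arm t) (t - τ) t)
      ≤ excess ω.arm (F.noise ω) η (τ / K) (ω.arm t) (t - τ) t := by
    unfold excess
    gcongr
    exact le_abs_self _
  rw [if_neg hn]
  linarith [hselected.2, hoptimal.1]

end Round

/-! ### The regret over the horizon -/

theorem card_pulls_window_eq_zero_le {α : Type*} [Fintype α] [DecidableEq α] (φ : ℕ → α)
    {τ m T : ℕ} (hm : T ≤ m * τ) :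
    {t ∈ Finset.range T | pulls φ (φ t) (t - τ) t = 0}.card ≤ m * Fintype.card α := by
  have hT : epochStart τ T m = T := min_eq_right hm
  rw [Finset.card_filter]
  conv_lhs => rw [← hT, sum_range_epochStart]
  calc ∑ i ∈ Finset.range m, ∑ t ∈ Finset.Ico (epochStart τ T i) (epochStart τ T (i + 1)),
        (if pulls φ (φ t) (t - τ) t = 0 then 1 else 0)
      = ∑ i ∈ Finset.range m, ∑ k,
          {t ∈ picks φ k (epochStart τ T i) (epochStart τ T (i + 1)) |
            pulls φ k (t - τ) t = 0}.card := by
        refine Finset.sum_congr rfl fun i _ => ?_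
        rw [sum_Ico_eq_sum_picks φ fun k t => if pulls φ k (t - τ) t = 0 then 1 else 0]
        simp only [Finset.card_filter]
    _ ≤ ∑ i ∈ Finset.range m, ∑ _k : α, 1 :=
        Finset.sum_le_sum fun i _ => Finset.sum_le_sum fun k _ =>
          card_picks_pulls_eq_zero_le_one (epochStart_succ_le τ T i)
    _ = m * Fintype.card α := by simp

/-- From round `K` on, up to the horizon `T`, the policy picks an arm of maximal index. -/
def Policy.MaximizesIndex (π : Policy K) (η : ℝ) (τ T : ℕ) : Prop :=
  ∀ t < T, K ≤ t → ∀ (h : Hist K t) (k : Fin K),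
    π.act t h {k} ≠ 0 → ∀ j, swIndex η τ h j ≤ swIndex η τ h k

theorem sum_bestMean_sub_mean_le {η b : ℝ} (hb : 0 ≤ b) {τ m : ℕ} (hm : T ≤ m * τ)
    (hgap : ∀ t < T, ∀ k, F.bestMean t - F.mean t k ≤ b) {ω : Path K}
    (hω : ∀ t < T, K ≤ t → ∀ j, swIndex η τ (ω.take t) j ≤ swIndex η τ (ω.take t) (ω.arm t)) :
    ∑ t ∈ Finset.range T, (F.bestMean t - F.mean t (ω.arm t)) ≤
      b * K + b * (m * K) + 2 * (τ * F.variation T)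
        + ∑ t ∈ Finset.range T, shortfall ω.arm (F.noise ω) η (τ / K) (F.bestArm t) (t - τ) t
        + ∑ t ∈ Finset.range T, excess ω.arm (F.noise ω) η (τ / K) (ω.arm t) (t - τ) t := by
  have hround : ∀ t ∈ Finset.range T, F.bestMean t - F.mean t (ω.arm t) ≤
      (if t < K then b else 0) + (if pulls ω.arm (ω.arm t) (t - τ) t = 0 then b else 0)
        + 2 * F.drift τ t
        + shortfall ω.arm (F.noise ω) η (τ / K) (F.bestArm t) (t - τ) t
        + excess ω.arm (F.noise ω) η (τ / K) (ω.arm t) (t - τ) t := by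
    intro t ht
    have hle := hgap t (Finset.mem_range.1 ht) (ω.arm t)
    rcases lt_or_ge t K with htK | htK
    · have hdrift := drift_nonneg F τ t
      have hunsampled : 0 ≤ if pulls ω.arm (ω.arm t) (t - τ) t = 0 then b else 0 := by positivity
      have hshort : 0 ≤ shortfall ω.arm (F.noise ω) η (τ / K) (F.bestArm t) (t - τ) t :=
        shortfall_nonneg
      have hexcess : 0 ≤ excess ω.arm (F.noise ω) η (τ / K) (ω.arm t) (t - τ) t := excess_nonneg
      rw [if_pos htK]
      linarith
    · rw [if_neg (not_lt.2 htK), zero_add]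
      exact bestMean_sub_mean_arm_le hle (hω t (Finset.mem_range.1 ht) htK)
  have hinit : ∑ t ∈ Finset.range T, (if t < K then b else 0) ≤ b * K := by
    have hcard : {t ∈ Finset.range T | t < K}.card ≤ K :=
      (Finset.card_le_card fun t ht => Finset.mem_range.2 (Finset.mem_filter.1 ht).2).trans
        (Finset.card_range K).le
    rw [← Finset.sum_filter, Finset.sum_const, nsmul_eq_mul, mul_comm]
    gcongr
  have hunsampled :
      ∑ t ∈ Finset.range T, (if pulls ω.arm (ω.arm t) (t - τ) t = 0 then b else 0)
        ≤ b * (m * K) := by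
    rw [← Finset.sum_filter, Finset.sum_const, nsmul_eq_mul, mul_comm]
    gcongr
    exact_mod_cast (card_pulls_window_eq_zero_le ω.arm hm).trans_eq (by simp)
  have hsum := Finset.sum_le_sum hround
  simp only [Finset.sum_add_distrib, ← Finset.mul_sum] at hsum
  linarith [sum_drift_le F τ T]

theorem regret_eq_integral (π : Policy K) (F : Env K) (T : ℕ) :
    π.regret F T
      = ∫ ω, ∑ t ∈ Finset.range T, (F.bestMean t - F.mean t (ω.arm t)) ∂(π.pathLaw F T) := by
  have hmeas : ∀ t, Measurable (F.mean t) := fun t => measurable_of_finite _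
  have hsum : Measurable fun ω : Path K =>
      ∑ t ∈ Finset.range T, (F.bestMean t - F.mean t (ω.arm t)) := by fun_prop
  rw [Policy.pathLaw, integral_map (measurable_pad T).aemeasurable hsum.aestronglyMeasurable]
  refine integral_congr_ae (Filter.Eventually.of_forall fun h => ?_)
  simp only
  rw [← Fin.sum_univ_eq_sum_range fun t => F.bestMean t - F.mean t ((Hist.pad h).arm t)]
  simp [Hist.pad, Path.arm]

theorem regret_le_of_lintegral_le {C : ℝ} (hC : 0 ≤ C)
    (h : ∫⁻ ω, ENNReal.ofReal (∑ t ∈ Finset.range T, (F.bestMean t - F.mean t (ω.arm t)))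
      ∂(π.pathLaw F T) ≤ ENNReal.ofReal C) : π.regret F T ≤ C := by
  have hmeas : ∀ t, Measurable (F.mean t) := fun t => measurable_of_finite _
  have hsum : Measurable fun ω : Path K =>
      ∑ t ∈ Finset.range T, (F.bestMean t - F.mean t (ω.arm t)) := by fun_prop
  rw [regret_eq_integral, integral_eq_lintegral_of_nonneg_ae
    (Filter.Eventually.of_forall fun ω => Finset.sum_nonneg fun t _ =>
      sub_nonneg.2 (mean_le_bestMean F _ t)) hsum.aestronglyMeasurable]
  exact ENNReal.toReal_le_of_le_ofReal hC h

theorem regret_le_mul_horizon {b : ℝ} (hb : 0 ≤ b)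
    (hgap : ∀ t < T, ∀ k, F.bestMean t - F.mean t k ≤ b) : π.regret F T ≤ b * T := by
  refine regret_le_of_lintegral_le (by positivity) ?_
  calc _ ≤ ∫⁻ _ω, ENNReal.ofReal (b * T) ∂(π.pathLaw F T) := by
        refine lintegral_mono fun ω => ENNReal.ofReal_le_ofReal ?_
        refine (Finset.sum_le_card_nsmul _ _ b fun t ht =>
          hgap t (Finset.mem_range.1 ht) _).trans_eq ?_
        rw [Finset.card_range, nsmul_eq_mul, mul_comm]
    _ = _ := by simp

theorem lintegral_sum_shortfall_le (hF : F.IsSubgaussian c T) (hc : 0 < c) {η H δ : ℝ}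
    (hH : 0 < H) (hδ : 0 < δ) (hδ2 : δ ≤ 1 / 2) (hδη : δ + 1 / 2 ≤ η / (4 * c)) (k : ℕ → Fin K)
    (u : ℕ → ℕ) :
    ∫⁻ ω, ENNReal.ofReal (∑ t ∈ Finset.range T,
        shortfall ω.arm (F.noise ω) η H (k t) (u t) t) ∂(π.pathLaw F T)
      ≤ ENNReal.ofReal (T * (8 * Real.exp c * dyadicConst δ / √H)) := by
  rw [lintegral_ofReal_sum _ (fun t _ => measurable_shortfall F η H (k t) (u t) t)
    fun _ _ _ => shortfall_nonneg]
  refine (Finset.sum_le_card_nsmul _ _ _ fun t ht =>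
    lintegral_shortfall_le hF hc hH hδ hδ2 hδη (k t) (Finset.mem_range.1 ht).le).trans_eq ?_
  rw [Finset.card_range, nsmul_eq_mul, ENNReal.ofReal_mul (Nat.cast_nonneg T),
    ENNReal.ofReal_natCast]

theorem regret_le_add (hF : F.IsSubgaussian c T) (hc : 0 < c) {η b δ : ℝ} (hη : 0 ≤ η)
    (hδ : 0 < δ) (hδ2 : δ ≤ 1 / 2) (hδη : δ + 1 / 2 ≤ η / (4 * c)) (hb : 0 ≤ b)
    (hgap : ∀ t < T, ∀ k, F.bestMean t - F.mean t k ≤ b) {τ m : ℕ} (hτ : 0 < τ)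
    (hm : T ≤ m * τ) (hπ : π.MaximizesIndex η τ T) :
    π.regret F T ≤ b * K + b * (m * K) + 2 * (τ * F.variation T)
      + T * (8 * Real.exp c * dyadicConst δ / √(τ / K)) + excessConst η c * m * (K * √(τ / K)) := by
  set H : ℝ := τ / K
  have hK : (0 : ℝ) < K := by exact_mod_cast NeZero.pos K
  have hH : 0 < H := by positivity
  have hvar := variation_nonneg F T
  have hconst : 0 ≤ b * K + b * (m * K) + 2 * (τ * F.variation T) := by positivity
  have hshort : 0 ≤ T * (8 * Real.exp c * dyadicConst δ / √H) := by
    have := dyadicConst_pos hδ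
    positivity
  have hexcess : 0 ≤ excessConst η c * m * (K * √H) := by
    have := excessConst_nonneg η c
    positivity
  refine regret_le_of_lintegral_le (by positivity) ?_
  calc _ ≤ ∫⁻ ω, (ENNReal.ofReal (b * K + b * (m * K) + 2 * (τ * F.variation T))
          + ENNReal.ofReal (∑ t ∈ Finset.range T,
            shortfall ω.arm (F.noise ω) η H (F.bestArm t) (t - τ) t)
          + ENNReal.ofReal (∑ t ∈ Finset.range T,
            excess ω.arm (F.noise ω) η H (ω.arm t) (t - τ) t)) ∂(π.pathLaw F T) := by
        refine lintegral_mono_ae ?_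
        filter_upwards [ae_act_ne_zero π F T] with ω hω
        refine (ENNReal.ofReal_le_ofReal (sum_bestMean_sub_mean_le hb hm hgap fun t ht htK =>
          hπ t ht htK _ _ (hω t ht))).trans ?_
        exact ENNReal.ofReal_add_le.trans (add_le_add_left ENNReal.ofReal_add_le _)
    _ ≤ _ := by
        have hmeas : ∀ t, Measurable fun ω : Path K =>
            shortfall ω.arm (F.noise ω) η H (F.bestArm t) (t - τ) t := fun t =>
          measurable_shortfall F η H _ _ t
        rw [lintegral_add_left (by fun_prop), lintegral_add_left measurable_const, lintegral_const,
          measure_univ, mul_one, ENNReal.ofReal_add (by positivity) hexcess,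
          ENNReal.ofReal_add hconst hshort]
        gcongr
        · exact lintegral_sum_shortfall_le hF hc hH hδ hδ2 hδη _ _
        · exact lintegral_sum_excess_le hF hη hτ hm

/-- The constant of the regret bound in terms of the window length, for noise with variance proxy
`c` and gaps of size at most `b`. -/
def regretConst (η c b : ℝ) : ℝ :=
  4 * b + 8 * Real.exp c * dyadicConst (min (1 / 2) (η / (4 * c) - 1 / 2)) + 2 * excessConst η c

theorem min_half_sub_half_pos {η c : ℝ} (hc : 0 < c) (hcη : 2 * c < η) :
    0 < min (1 / 2) (η / (4 * c) - 1 / 2) := by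
  refine lt_min one_half_pos (sub_pos.2 ?_)
  rw [lt_div_iff₀ (by positivity)]
  linarith

theorem regretConst_nonneg {η c b : ℝ} (hc : 0 < c) (hcη : 2 * c < η) (hb : 0 ≤ b) :
    0 ≤ regretConst η c b := by
  have hshort := dyadicConst_pos (min_half_sub_half_pos hc hcη)
  have hexcess := excessConst_nonneg η c
  unfold regretConst
  positivity

theorem mul_sqrt_div_le_div_sqrt {K τ T m : ℝ} (hK : 0 < K) (hτ : 0 < τ) (hm : m * τ ≤ 2 * T) :
    m * (K * √(τ / K)) ≤ 2 * (T / √(τ / K)) := by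
  rw [mul_div_assoc', le_div_iff₀ (Real.sqrt_pos.2 (div_pos hτ hK)), mul_assoc, mul_assoc,
    Real.mul_self_sqrt (div_pos hτ hK).le, mul_div_cancel₀ _ hK.ne']
  exact hm

theorem regret_le_window (hF : F.IsSubgaussian c T) (hc : 0 < c) {η b : ℝ} (hcη : 2 * c < η)
    (hb : 0 ≤ b) (hgap : ∀ t < T, ∀ k, F.bestMean t - F.mean t k ≤ b) {τ : ℕ} (hKτ : K ≤ τ)
    (hτT : τ ≤ T) (hπ : π.MaximizesIndex η τ T) :
    π.regret F T ≤ regretConst η c b * (T / √(τ / K)) + 2 * (τ * F.variation T) := by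
  have hc' : (0 : ℝ) < c := hc
  have hK : (0 : ℝ) < K := by exact_mod_cast NeZero.pos K
  have hτ : 0 < τ := (NeZero.pos K).trans_le hKτ
  have hτ' : (0 : ℝ) < τ := by exact_mod_cast hτ
  set m := T / τ + 1 with hm
  have hmT : T ≤ m * τ := (Nat.lt_mul_of_div_lt (Nat.lt_succ_self _) hτ).le
  have hmT2 : (m : ℝ) * τ ≤ 2 * T := by
    have hdiv := Nat.div_mul_le_self T τ
    have : m * τ ≤ 2 * T := by rw [hm, add_one_mul]; omega
    exact_mod_cast this
  have hm1 : (1 : ℝ) ≤ m := by exact_mod_cast Nat.le_add_left 1 _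
  have hsqrt : 1 ≤ √((τ : ℝ) / K) := by
    rw [Real.one_le_sqrt, one_le_div hK]
    exact_mod_cast hKτ
  have hsamples : m * (K * √((τ : ℝ) / K)) ≤ 2 * (T / √(τ / K)) :=
    mul_sqrt_div_le_div_sqrt hK hτ' hmT2
  have hunsampled : (m * K : ℝ) ≤ 2 * (T / √(τ / K)) := by
    refine le_trans ?_ hsamples
    gcongr
    exact le_mul_of_one_le_right hK.le hsqrt
  have hinit : (K : ℝ) ≤ 2 * (T / √(τ / K)) :=
    (le_mul_of_one_le_left hK.le hm1).trans hunsampled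
  have hδ := min_half_sub_half_pos hc' hcη
  set δ := min (1 / 2) (η / (4 * c) - 1 / 2) with hδdef
  have hδη : δ + 1 / 2 ≤ η / (4 * c) := by linarith [min_le_right (1 / 2) (η / (4 * c) - 1 / 2)]
  have hη : 0 ≤ η := by linarith
  calc π.regret F T ≤ _ :=
        regret_le_add hF hc hη hδ (min_le_left _ _) hδη hb hgap hτ hmT hπ
    _ = b * K + b * (m * K) + 8 * Real.exp c * dyadicConst δ * (T / √(τ / K))
          + excessConst η c * (m * (K * √(τ / K))) + 2 * (τ * F.variation T) := by ring
    _ ≤ b * (2 * (T / √(τ / K))) + b * (2 * (T / √(τ / K)))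
          + 8 * Real.exp c * dyadicConst δ * (T / √(τ / K))
          + excessConst η c * (2 * (T / √(τ / K))) + 2 * (τ * F.variation T) := by
        have := excessConst_nonneg η c
        gcongr
    _ = regretConst η c b * (T / √(τ / K)) + 2 * (τ * F.variation T) := by
        rw [regretConst, ← hδdef]
        ring

/-! ### The choice of the window length -/

section WindowLength

variable {K T V : ℝ}

theorem rpow_third_mul_rpow_two_thirds {x : ℝ} (hx : 0 ≤ x) :
    x ^ (1 / 3 : ℝ) * x ^ (2 / 3 : ℝ) = x := by
  rw [← Real.rpow_add_of_nonneg hx (by norm_num) (by norm_num)]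
  norm_num

theorem le_rate_of_le_mul (hT : 0 ≤ T) (h : T ≤ K * V) :
    T ≤ (K * V) ^ (1 / 3 : ℝ) * T ^ (2 / 3 : ℝ) := by
  calc T = T ^ (1 / 3 : ℝ) * T ^ (2 / 3 : ℝ) := (rpow_third_mul_rpow_two_thirds hT).symm
    _ ≤ (K * V) ^ (1 / 3 : ℝ) * T ^ (2 / 3 : ℝ) := by gcongr

theorem le_rpow_third_mul_div_rpow_two_thirds (hK : 0 ≤ K) (hV : 0 < V) (h : K * V ≤ T) :
    K ≤ K ^ (1 / 3 : ℝ) * (T / V) ^ (2 / 3 : ℝ) := by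
  calc K = K ^ (1 / 3 : ℝ) * K ^ (2 / 3 : ℝ) := (rpow_third_mul_rpow_two_thirds hK).symm
    _ ≤ K ^ (1 / 3 : ℝ) * (T / V) ^ (2 / 3 : ℝ) := by
        gcongr
        exact (le_div_iff₀ hV).2 h

theorem rpow_third_mul_div_rpow_two_thirds_mul (hK : 0 ≤ K) (hV : 0 < V) (hT : 0 ≤ T) :
    K ^ (1 / 3 : ℝ) * (T / V) ^ (2 / 3 : ℝ) * V = (K * V) ^ (1 / 3 : ℝ) * T ^ (2 / 3 : ℝ) := by
  rw [Real.div_rpow hT hV.le, Real.mul_rpow hK hV.le]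
  nth_rewrite 2 [← rpow_third_mul_rpow_two_thirds hV.le]
  field_simp

theorem div_sqrt_rpow_third_mul_div_rpow_two_thirds (hK : 0 < K) (hV : 0 < V) (hT : 0 < T) :
    T / √(K ^ (1 / 3 : ℝ) * (T / V) ^ (2 / 3 : ℝ) / K)
      = (K * V) ^ (1 / 3 : ℝ) * T ^ (2 / 3 : ℝ) := by
  have hsq : K ^ (1 / 3 : ℝ) * (T / V) ^ (2 / 3 : ℝ) / K = ((T / (K * V)) ^ (1 / 3 : ℝ)) ^ 2 := by
    rw [← Real.rpow_mul_natCast (by positivity), div_eq_iff hK.ne', mul_comm K, ← div_div,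
      Real.div_rpow (by positivity) hK.le]
    nth_rewrite 3 [← rpow_third_mul_rpow_two_thirds hK.le]
    norm_num
    field_simp
  rw [hsq, Real.sqrt_sq (by positivity), Real.div_rpow hT.le (by positivity), div_div_eq_mul_div,
    div_eq_iff (by positivity)]
  nth_rewrite 1 [← rpow_third_mul_rpow_two_thirds hT.le]
  ring

end WindowLength

theorem regret_le_swWindow (hF : F.IsSubgaussian c T) (hc : 0 < c) {η b V : ℝ}
    (hcη : 2 * c < η) (hb : 0 ≤ b) (hgap : ∀ t < T, ∀ k, F.bestMean t - F.mean t k ≤ b)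
    (hV : 0 < V) (hvar : F.variation T ≤ V) (hKV : K * V ≤ T) (hT : swWindow K T V ≤ T)
    (hπ : π.MaximizesIndex η (swWindow K T V) T) :
    π.regret F T ≤ (regretConst η c b + 4) * ((K * V) ^ (1 / 3 : ℝ) * (T : ℝ) ^ (2 / 3 : ℝ)) := by
  have hK1 : (1 : ℝ) ≤ K := by exact_mod_cast NeZero.pos K
  have hK : (0 : ℝ) < K := one_pos.trans_le hK1
  have hT0 : (0 : ℝ) < T := (mul_pos hK hV).trans_le hKV
  set rate := (K * V) ^ (1 / 3 : ℝ) * (T : ℝ) ^ (2 / 3 : ℝ)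
  set x := (K : ℝ) ^ (1 / 3 : ℝ) * (T / V) ^ (2 / 3 : ℝ)
  have hKx : K ≤ x := le_rpow_third_mul_div_rpow_two_thirds hK.le hV hKV
  have hxτ : x ≤ swWindow K T V := Nat.le_ceil x
  have hτx : (swWindow K T V : ℝ) ≤ 2 * x := by
    have : (swWindow K T V : ℝ) < x + 1 := Nat.ceil_lt_add_one (hK.le.trans hKx)
    linarith
  have hx0 : 0 < x := hK.trans_le hKx
  have hnoise : T / √(swWindow K T V / K) ≤ rate := by
    calc T / √(swWindow K T V / K) ≤ T / √(x / K) := by gcongr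
      _ = rate := div_sqrt_rpow_third_mul_div_rpow_two_thirds hK hV hT0
  have hvar0 := variation_nonneg F T
  have hdrift : swWindow K T V * F.variation T ≤ 2 * rate := by
    calc swWindow K T V * F.variation T ≤ 2 * x * V := by gcongr
      _ = 2 * rate := by
        rw [mul_assoc, rpow_third_mul_div_rpow_two_thirds_mul hK.le hV hT0.le]
  calc π.regret F T ≤ regretConst η c b * (T / √(swWindow K T V / K))
        + 2 * (swWindow K T V * F.variation T) :=
        regret_le_window hF hc hcη hb hgap (by exact_mod_cast hKx.trans hxτ) hT hπ
    _ ≤ regretConst η c b * rate + 2 * (2 * rate) := by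
        have := regretConst_nonneg (b := b) (NNReal.coe_pos.2 hc) hcη hb
        gcongr
    _ = (regretConst η c b + 4) * rate := by ring

omit [NeZero K] in
theorem bestMean_sub_mean_le_of_mem_Icc {a b : ℝ} {t : ℕ}
    (h : ∀ k, F.mean t k ∈ Set.Icc a (a + b)) (k : Fin K) : F.bestMean t - F.mean t k ≤ b := by
  have : Nonempty (Fin K) := ⟨k⟩
  have hbest : F.bestMean t ≤ a + b := ciSup_le fun j => (h j).2
  linarith [(h k).1]

end Bandit

end

theorem theorem2_general (η b : ℝ) (c : NNReal) (hc : 0 < c) (hcη : 2 * c < η) (hb : 0 ≤ b) :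
    ∃ C : ℝ, ∀ (K T : ℕ) (V : ℝ), 0 < K → 0 < V → Bandit.swWindow K T V ≤ T →
      ∀ π : Bandit.Policy K, π.MaximizesIndex η (Bandit.swWindow K T V) T →
        ∀ F : Bandit.Env K, F.IsSubgaussian c T →
          (∀ t < T, ∀ k, F.bestMean t - F.mean t k ≤ b) → F.variation T ≤ V →
            π.regret F T ≤ C * (((K : ℝ) * V) ^ (1 / 3 : ℝ) * (T : ℝ) ^ (2 / 3 : ℝ)) := by
  refine ⟨b + (Bandit.regretConst η c b + 4), fun K T V hK hV hT π hπ F hF hgap hvar => ?_⟩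
  have : NeZero K := ⟨hK.ne'⟩
  have hconst := Bandit.regretConst_nonneg (NNReal.coe_pos.2 hc) hcη hb
  rw [add_mul]
  rcases le_total (T : ℝ) (K * V) with hTV | hTV
  · refine le_add_of_le_of_nonneg ?_ (by positivity)
    exact (Bandit.regret_le_mul_horizon hb hgap).trans
      (mul_le_mul_of_nonneg_left (Bandit.le_rate_of_le_mul T.cast_nonneg hTV) hb)
  · exact le_add_of_nonneg_of_le (by positivity)
      (Bandit.regret_le_swWindow hF hc hcη hb hgap hV hvar hTV hT hπ)

theorem theorem2 (η b : ℝ) (hη : 1 / 2 < η) (hb : 0 < b) :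
    ∃ C : ℝ, ∀ (a : ℝ) (K T : ℕ) (V : ℝ), 0 < K → 0 < V → Bandit.swWindow K T V ≤ T →
      ∀ π : Bandit.Policy K, π.IsSWMOSS η (Bandit.swWindow K T V) T →
        π.worstCaseRegret T V a b
          ≤ ((C * (((K : ℝ) * V) ^ (1 / 3 : ℝ) * (T : ℝ) ^ (2 / 3 : ℝ)) : ℝ) : EReal) := by
  obtain ⟨C, hC⟩ := theorem2_general η b (1 / 4) (by positivity) (by push_cast; linarith) hb.le
  exact ⟨C, fun a K T V hK hV hT π hπ => iSup₂_le fun F hF => EReal.coe_le_coe_iff.2 <|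
    hC K T V hK hV hT π hπ.argmax F (fun t ht k => (hF.1 t ht k).1)
      (fun t ht k => Bandit.bestMean_sub_mean_le_of_mem_Icc (fun j => (hF.1 t ht j).2) k) hF.2⟩
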